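/- Let $k$ be an arbitrary field. Let $\Delta\subseteq\mathbb{R}^n$ be a (bounded, convex) lattice polytope, i.e. the convex hull of a finite subset of $\mathbb{Z}^n$, of dimension greater than one, and let $\Delta'\subseteq\mathbb{R}^n$ be an arbitrary convex set. Put $S=\Delta'\cap\mathbb{Z}^n$, $T=\Delta\cap\mathbb{Z}^n$, $p=\#T-1$ and $X=\{P\in\mathbb{Z}^n : P+T\subseteq S\}$. For a set $U\subseteq\mathbb{Z}^n$ write $U$ also for the $k$-vector space with basis $U$. For $1\le i\le p$ let $$\delta_i:S^{\otimes p}\otimes T\to S^{\otimes(p-1)}\otimes(S+T),\quad P_1\otimes\cdots\otimes P_p\otimes Q\mapsto P_1\otimes\cdots\otimes\widehat{P_i}\otimes\cdots\otimes P_p\otimes(P_i+Q),$$ and let $$\delta:\bigwedge^pS\otimes T\to\bigwedge^{p-1}S\otimes(S+T),\quad P_1\wedge\cdots\wedge P_p\otimes Q\mapsto\sum_{i=1}^p(-1)^iP_1\wedge\cdots\wedge\widehat{P_i}\wedge\cdots\wedge P_p\otimes(P_i+Q).$$ Here $P_i+Q$ is the sum in $\mathbb{Z}^n$. Fix a list $Q_1,\dots,Q_{p+1}$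 of all the points of $T$. For $P_1,\dots,P_p\in X$ let $$x_{P_1,\dots,P_p}=\sum_{\sigma\in S_{p+1}}\operatorname{sgn}(\sigma)\,(P_1+Q_{\sigma(1)})\otimes\cdots\otimes(P_p+Q_{\sigma(p)})\otimes Q_{\sigma(p+1)}.$$ For a monomial $A=P_1\cdots P_p$ of degree $p$ in the elements of $X$ as variables, with $R\in X$ occurring $a_R$ times, let $$x_A=\prod_{R}\frac1{a_R!}\sum_{\sigma\in S_{p+1}}\operatorname{sgn}(\sigma)\,(P_1+Q_{\sigma(1)})\wedge\cdots\wedge(P_p+Q_{\sigma(p)})\otimes Q_{\sigma(p+1)},$$ where, over any field, the division by $\prod_R a_R!$ means that one sums over one representative $\sigma$ of each class of the relation $\sigma\sim\sigma'\iff\sigma(\{i:P_i=R\})=\sigma'(\{i:P_i=R\})$ for all $R\in X$ (equivalent permutations give equal terms, and each class has $\prod_R a_R!$ elements). Then the family of all $x_{P_1,\dots,P_p}$, indexed by the sequences $(P_1,\dots,P_p)\in X^p$, is a basis of $\bigcap_{i=1}^p\ker\delta_i$. Moreover, for any choice of a list $P_1,\dots,P_p$ for each monomial, the family of all $x_A$,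 indexed by the monomials $A$ of degree $p$ with variables in $X$, is a basis of $\ker\delta$. -/

import Mathlib

open scoped TensorProduct Pointwise

set_option maxSynthPendingDepth 3

noncomputable section

/-- The set `Δ ∩ ℤⁿ` of lattice points of a subset `Δ` of `ℝⁿ`. -/
def latticePoints {n : ℕ} (Δ : Set (Fin n → ℝ)) : Set (Fin n → ℤ) :=
  {P | (fun i => (P i : ℝ)) ∈ Δ}

/-- A (bounded, convex) lattice polytope in `ℝⁿ`: the convex hull of a finite set of points
of `ℤⁿ`. -/
def IsLatticePolytope {n : ℕ} (Δ : Set (Fin n → ℝ)) : Prop :=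
  ∃ V : Finset (Fin n → ℤ), Δ = convexHull ℝ ((fun P i => (P i : ℝ)) '' (V : Set (Fin n → ℤ)))

/-- The dimension of a subset of `ℝⁿ`: the dimension of its affine span. -/
def affineDim {n : ℕ} (Δ : Set (Fin n → ℝ)) : ℕ :=
  Module.finrank ℝ (vectorSpan ℝ Δ)

/-- The set `X = {P ∈ ℤⁿ | P + T ⊆ S}`. -/
def shiftSet {n : ℕ} (S T : Set (Fin n → ℤ)) : Set (Fin n → ℤ) :=
  {P | ∀ Q ∈ T, P + Q ∈ S}

/-- The point `P + Q` of `S`, for `P ∈ X` and `Q ∈ T`. -/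
def shiftPoint {n : ℕ} {S T : Set (Fin n → ℤ)} (P : shiftSet S T) (Q : T) : S :=
  ⟨P.1 + Q.1, P.2 Q.1 Q.2⟩

/-- The vector space over `k` with basis the set of points `S`. -/
abbrev PointSpace (k : Type*) [Field k] {n : ℕ} (S : Set (Fin n → ℤ)) := S →₀ k

/-- The point `P` of `S`, seen as a basis vector of the vector space with basis `S`. -/
abbrev pt (k : Type*) [Field k] {n : ℕ} {S : Set (Fin n → ℤ)} (P : S) : PointSpace k S :=
  Finsupp.single P 1

/-- The bilinear map `S × T → S + T` given by `(P, Q) ↦ P + Q` on basis vectors. -/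
def addPoints (k : Type*) [Field k] {n : ℕ} (S T : Set (Fin n → ℤ)) :
    PointSpace k S →ₗ[k] PointSpace k T →ₗ[k] PointSpace k (S + T) :=
  Finsupp.linearCombination k fun P : S =>
    Finsupp.lmapDomain k k fun Q : T => (⟨P.1 + Q.1, Set.add_mem_add P.2 Q.2⟩ : ↥(S + T))

theorem addPoints_pt (k : Type*) [Field k] {n : ℕ} {S T : Set (Fin n → ℤ)} (P : S) (Q : T) :
    addPoints k S T (pt k P) (pt k Q) = pt k ⟨P.1 + Q.1, Set.add_mem_add P.2 Q.2⟩ := by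
  simp [addPoints]

/-- For a `k`-vector space `W`, the trilinear map `(v, w, t) ↦ w ⊗ (v + t)`, where `v + t` stands
for the bilinear extension of the addition of points. -/
def absorb (k : Type*) [Field k] {n : ℕ} (S T : Set (Fin n → ℤ))
    (W : Type*) [AddCommGroup W] [Module k W] :
    PointSpace k S →ₗ[k] W →ₗ[k] PointSpace k T →ₗ[k] W ⊗[k] PointSpace k (S + T) :=
  LinearMap.mk₂ k (fun v w => TensorProduct.mk k W (PointSpace k (S + T)) w ∘ₗ addPoints k S T v)
    (fun _ _ _ => by simp [LinearMap.comp_add])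
    (fun _ _ _ => by simp [LinearMap.comp_smul])
    (fun _ _ _ => by simp [LinearMap.add_comp])
    (fun _ _ _ => by simp [LinearMap.smul_comp])

/-- The map `δ : ⋀ᵖ⁺¹ S ⊗ T → ⋀ᵖ S ⊗ (S + T)`, characterised by `wedgeDelta_apply`. -/
def wedgeDelta (k : Type*) [Field k] {n : ℕ} (S T : Set (Fin n → ℤ)) (p : ℕ) :
    (⋀[k]^(p + 1) (PointSpace k S)) ⊗[k] PointSpace k T →ₗ[k]
      (⋀[k]^p (PointSpace k S)) ⊗[k] PointSpace k (S + T) :=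
  -TensorProduct.lift (exteriorPower.alternatingMapLinearEquiv
    (AlternatingMap.alternatizeUncurryFin
      (exteriorPower.alternatingMapLinearEquiv.symm.toLinearMap ∘ₗ
        absorb k S T (⋀[k]^p (PointSpace k S)))))

theorem wedgeDelta_apply (k : Type*) [Field k] {n : ℕ} {S T : Set (Fin n → ℤ)} (p : ℕ)
    (P : Fin (p + 1) → S) (Q : T) :
    wedgeDelta k S T p (exteriorPower.ιMulti k (p + 1) (fun i => pt k (P i)) ⊗ₜ[k] pt k Q) =
      ∑ i : Fin (p + 1), (-1 : ℤ) ^ ((i : ℕ) + 1) •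
        (exteriorPower.ιMulti k p (fun j => pt k (P (i.succAbove j))) ⊗ₜ[k]
          pt k (⟨(P i).1 + Q.1, Set.add_mem_add (P i).2 Q.2⟩ : ↥(S + T))) := by
  simp [wedgeDelta, absorb, AlternatingMap.alternatizeUncurryFin_apply, LinearMap.sum_apply,
    addPoints_pt, pow_succ, ← Finset.sum_neg_distrib]
  rfl

/-- The map `δ_i : S^{⊗(p+1)} ⊗ T → S^{⊗p} ⊗ (S + T)`, characterised by `tensorDelta_apply`. -/
def tensorDelta (k : Type*) [Field k] {n : ℕ} (S T : Set (Fin n → ℤ)) (p : ℕ) (i : Fin (p + 1)) :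
    (⨂[k]^(p + 1) (PointSpace k S)) ⊗[k] PointSpace k T →ₗ[k]
      (⨂[k]^p (PointSpace k S)) ⊗[k] PointSpace k (S + T) :=
  TensorProduct.lift (PiTensorProduct.lift (LinearMap.uncurryMid i
    (PiTensorProduct.lift.symm.toLinearMap ∘ₗ absorb k S T (⨂[k]^p (PointSpace k S)))))

theorem tensorDelta_apply (k : Type*) [Field k] {n : ℕ} {S T : Set (Fin n → ℤ)} (p : ℕ)
    (i : Fin (p + 1)) (P : Fin (p + 1) → S) (Q : T) :
    tensorDelta k S T p i (PiTensorProduct.tprod k (fun j => pt k (P j)) ⊗ₜ[k] pt k Q) =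
      PiTensorProduct.tprod k (fun j => pt k (P (i.succAbove j))) ⊗ₜ[k]
        pt k (⟨(P i).1 + Q.1, Set.add_mem_add (P i).2 Q.2⟩ : ↥(S + T)) := by
  simp [tensorDelta, absorb, addPoints_pt]
  rfl

/-- The kernel of `δ` on `⋀ᵖ S ⊗ T`; for `p = 0` the target of `δ` is zero. -/
def wedgeKer (k : Type*) [Field k] {n : ℕ} (S T : Set (Fin n → ℤ)) : (p : ℕ) →
    Submodule k ((⋀[k]^p (PointSpace k S)) ⊗[k] PointSpace k T)
  | 0 => ⊤
  | p + 1 => LinearMap.ker (wedgeDelta k S T p)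

/-- The intersection of the kernels of `δ_1, …, δ_p` on `S^{⊗p} ⊗ T`; for `p = 0` there is nothing
to intersect. -/
def tensorKer (k : Type*) [Field k] {n : ℕ} (S T : Set (Fin n → ℤ)) : (p : ℕ) →
    Submodule k ((⨂[k]^p (PointSpace k S)) ⊗[k] PointSpace k T)
  | 0 => ⊤
  | p + 1 => ⨅ i : Fin (p + 1), LinearMap.ker (tensorDelta k S T p i)

/-- `x_{P_1,…,P_p} = ∑_σ sgn(σ) (P_1 + Q_{σ(1)}) ⊗ ⋯ ⊗ (P_p + Q_{σ(p)}) ⊗ Q_{σ(p+1)}`, the sum being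
over the permutations of `p + 1` letters, where `Q` lists the points of `T`. -/
def xTensor (k : Type*) [Field k] {n : ℕ} {S T : Set (Fin n → ℤ)} {p : ℕ}
    (Q : Fin (p + 1) ≃ T) (P : Fin p → shiftSet S T) :
    (⨂[k]^p (PointSpace k S)) ⊗[k] PointSpace k T :=
  ∑ σ : Equiv.Perm (Fin (p + 1)), Equiv.Perm.sign σ •
    (PiTensorProduct.tprod k (fun i : Fin p => pt k (shiftPoint (P i) (Q (σ i.castSucc)))) ⊗ₜ[k]
      pt k (Q (σ (Fin.last p))))

/-- The term `sgn(σ) (P_1 + Q_{σ(1)}) ∧ ⋯ ∧ (P_p + Q_{σ(p)}) ⊗ Q_{σ(p+1)}`. -/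
def wedgeTerm (k : Type*) [Field k] {n : ℕ} {S T : Set (Fin n → ℤ)} {p : ℕ}
    (Q : Fin (p + 1) ≃ T) (P : Fin p → shiftSet S T) (σ : Equiv.Perm (Fin (p + 1))) :
    (⋀[k]^p (PointSpace k S)) ⊗[k] PointSpace k T :=
  Equiv.Perm.sign σ •
    (exteriorPower.ιMulti k p (fun i : Fin p => pt k (shiftPoint (P i) (Q (σ i.castSucc)))) ⊗ₜ[k]
      pt k (Q (σ (Fin.last p))))

/-- Two permutations `σ, σ'` are equivalent if `σ({i | P_i = R}) = σ'({i | P_i = R})` for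
all `R ∈ X`. -/
def permSetoid {n : ℕ} {S T : Set (Fin n → ℤ)} {p : ℕ} (P : Fin p → shiftSet S T) :
    Setoid (Equiv.Perm (Fin (p + 1))) where
  r σ σ' := ∀ R : shiftSet S T,
    (fun i : Fin p => σ i.castSucc) '' {i | P i = R} =
      (fun i : Fin p => σ' i.castSucc) '' {i | P i = R}
  iseqv := ⟨fun _ _ => rfl, fun h R => (h R).symm, fun h h' R => (h R).trans (h' R)⟩

theorem wedgeTerm_eq_of_equiv (k : Type*) [Field k] {n : ℕ} {S T : Set (Fin n → ℤ)} {p : ℕ}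
    (Q : Fin (p + 1) ≃ T) (P : Fin p → shiftSet S T) (σ σ' : Equiv.Perm (Fin (p + 1)))
    (h : (permSetoid P).r σ σ') : wedgeTerm k Q P σ = wedgeTerm k Q P σ' := by
  have hex : ∀ i : Fin p, ∃ j : Fin p, P j = P i ∧ σ j.castSucc = σ' i.castSucc := by
    intro i
    have hi : σ' i.castSucc ∈ (fun i : Fin p => σ i.castSucc) '' {j | P j = P i} := by
      rw [h (P i)]
      exact ⟨i, rfl, rfl⟩
    obtain ⟨j, hj, hj'⟩ := hi
    exact ⟨j, hj, hj'⟩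
  choose f hf hfσ using hex
  have hinj : Function.Injective f := by
    intro i j hij
    have h1 := hfσ i
    rw [hij, hfσ j] at h1
    exact (Fin.castSucc_injective p (σ'.injective h1)).symm
  let e : Equiv.Perm (Fin p) := Equiv.ofBijective f (Finite.injective_iff_bijective.mp hinj)
  have he : ∀ i, e i = f i := fun _ => rfl
  let c : Fin p ↪ Fin (p + 1) := Fin.castSuccEmb
  have hc : ∀ i, c i = i.castSucc := fun _ => rfl
  let τ : Equiv.Perm (Fin (p + 1)) := e.viaFintypeEmbedding c
  have hτ : ∀ i : Fin p, τ i.castSucc = (f i).castSucc := by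
    intro i
    have := Equiv.Perm.viaFintypeEmbedding_apply_image e c i
    simpa [hc, he] using this
  have hτl : τ (Fin.last p) = Fin.last p := by
    apply Equiv.Perm.viaFintypeEmbedding_apply_notMem_range
    rintro ⟨i, hi⟩
    exact Fin.castSucc_ne_last i hi
  have hcast : ∀ i : Fin p, (σ * τ) i.castSucc = σ' i.castSucc := by
    intro i
    rw [Equiv.Perm.mul_apply, hτ, hfσ]
  have hlast : σ' (Fin.last p) = σ (Fin.last p) := by
    obtain ⟨a, ha⟩ := σ'.surjective (σ (Fin.last p))
    induction a using Fin.lastCases with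
    | last => exact ha
    | cast i =>
      exfalso
      rw [← hfσ i] at ha
      exact Fin.castSucc_ne_last _ (σ.injective ha)
  have hσ : σ' = σ * τ := by
    ext a
    induction a using Fin.lastCases with
    | last => rw [hlast, Equiv.Perm.mul_apply, hτl]
    | cast i => rw [hcast]
  have hsign : Equiv.Perm.sign σ' = Equiv.Perm.sign σ * Equiv.Perm.sign e := by
    rw [hσ, map_mul, Equiv.Perm.viaFintypeEmbedding_sign]
  have hfun : (fun i : Fin p => pt k (shiftPoint (P i) (Q (σ' i.castSucc)))) =
      (fun i : Fin p => pt k (shiftPoint (P i) (Q (σ i.castSucc)))) ∘ e := by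
    funext i
    simp only [Function.comp_apply, he, hf, hfσ]
  unfold wedgeTerm
  rw [hfun, AlternatingMap.map_perm, hsign, hlast, mul_smul]
  congr 1
  rcases Int.units_eq_one_or (Equiv.Perm.sign e) with h1 | h1 <;>
    simp only [h1, one_smul, Units.neg_smul, TensorProduct.neg_tmul, neg_neg]

open Classical in
/-- The element
`x_A = ∏_R (1 / a_R!) ∑_σ sgn(σ) (P_1 + Q_{σ(1)}) ∧ ⋯ ∧ (P_p + Q_{σ(p)}) ⊗ Q_{σ(p+1)}`
for the monomial `A = P_1 ⋯ P_p`, in which `R` occurs `a_R` times. The terms of equivalent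
permutations are equal, and there are `∏_R a_R!` permutations in each class; so that the definition
makes sense over any field, the division is carried out by summing one term for each class. -/
def xWedge (k : Type*) [Field k] {n : ℕ} {S T : Set (Fin n → ℤ)} {p : ℕ}
    (Q : Fin (p + 1) ≃ T) (P : Fin p → shiftSet S T) :
    (⋀[k]^p (PointSpace k S)) ⊗[k] PointSpace k T :=
  ∑ c : Quotient (permSetoid P), Quotient.lift (wedgeTerm k Q P) (wedgeTerm_eq_of_equiv k Q P) c

end

set_option linter.unusedSectionVars false

noncomputable section

/-! Read `P_1 ⊗ ⋯ ⊗ P_p ⊗ Q` as the Laurent monomial `x_1^{P_1} ⋯ x_p^{P_p} x_{p+1}^Q`, each `x_i`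
standing for `n` variables. This embeds the tensor space into a Laurent polynomial ring and turns
`δ_i` into the substitution of `x_i` for `x_{p+1}`. Let `V = det (x_i^{Q_j})`. The image of
`x_{P_1,…,P_p}` is `V x_1^{P_1} ⋯ x_p^{P_p}` (`tensorHom_xTensor`), so the claim is that the
polynomials with exponents in `S^p × T` killed by all the substitutions are exactly the multiples `V
g` with `g` supported in `X^p × {0}`.

Divisibility by `V` (`vdm_dvd`): write `f = ∑_j F_j x_{p+1}^{Q_j}`. The row `F` times the matrix of
`V` is `(0, …, 0, f)`, and the adjugate gives `f C = V F_0` with a cofactor `C` free of `x_{p+1}`.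
After cancelling common factors in the UFD of Laurent polynomials, what remains of `C` divides `V`
and is still homogeneous in `x_{p+1}`. Such a divisor is a monomial because the points of `T` are
not collinear (`subsingleton_of_mul_eq_vdm`); this is where dimension greater than one enters.

The support of `g` is controlled by additivity of top degrees in products: every linear functional
bounds the exponents of `g` in terms of those of `f` and `V`, and separation by hyperplanes, with
convexity of `Δ'`, puts them in `X` (`exists_eq_vdm_mul`).

For the exterior power the monomial `x_1^{P_1} ⋯ x_p^{P_p}` is replaced by `det (x_j^{P_i})`. The
image is antisymmetric in the first `p` variables, as is `V`, so `g` is symmetric, and `x_A`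
corresponds to `V` times the monomial symmetric function of `A` (`wedgeHom_xWedge`). -/

namespace LaurentAlg

open AddMonoidAlgebra

/-! ### Top degrees with respect to a linear functional on the exponents -/

section Top

variable {k Γ L : Type*} [Field k] [AddCommGroup Γ] [AddCommGroup L] [LinearOrder L]
  [IsOrderedAddMonoid L]

open Classical in
/-- The part of `f` whose exponents have `φ`-degree `m`. -/
def component (φ : Γ →+ L) (m : L) (f : AddMonoidAlgebra k Γ) : AddMonoidAlgebra k Γ :=
  ofCoeff (f.coeff.filter fun γ => φ γ = m)

open Classical in
theorem coeff_component (φ : Γ →+ L) (m : L) (f : AddMonoidAlgebra k Γ) (γ : Γ) :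
    (component φ m f).coeff γ = if φ γ = m then f.coeff γ else 0 :=
  Finsupp.filter_apply _ _ _

theorem component_add (φ : Γ →+ L) (m : L) (f g : AddMonoidAlgebra k Γ) :
    component φ m (f + g) = component φ m f + component φ m g := by
  ext γ
  simp only [coeff_component, coeff_add, Finsupp.add_apply]
  split_ifs <;> simp

theorem component_zero (φ : Γ →+ L) (m : L) : component φ m (0 : AddMonoidAlgebra k Γ) = 0 := by
  ext γ
  simp [coeff_component]

theorem component_sum {α : Type*} (φ : Γ →+ L) (m : L) (s : Finset α)
    (f : α → AddMonoidAlgebra k Γ) :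
    component φ m (∑ a ∈ s, f a) = ∑ a ∈ s, component φ m (f a) :=
  map_sum (⟨⟨component φ m, component_zero φ m⟩, component_add φ m⟩ :
    AddMonoidAlgebra k Γ →+ AddMonoidAlgebra k Γ) f s

open Classical in
theorem component_single (φ : Γ →+ L) (m : L) (γ : Γ) (a : k) :
    component φ m (single γ a) = if φ γ = m then single γ a else 0 := by
  ext γ'
  by_cases h : γ = γ'
  · subst h
    rw [coeff_component]
    split_ifs <;> simp
  · rw [coeff_component]
    split_ifs <;> simp [h]

theorem component_eq_self (φ : Γ →+ L) (m : L) (f : AddMonoidAlgebra k Γ)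
    (h : ∀ γ ∈ f.coeff.support, φ γ = m) : component φ m f = f := by
  ext γ
  rw [coeff_component]
  split_ifs with h'
  · rfl
  · by_contra h0
    exact h' (h γ (by simpa [eq_comm] using h0))

theorem component_eq_zero (φ : Γ →+ L) (m : L) (f : AddMonoidAlgebra k Γ)
    (h : ∀ γ ∈ f.coeff.support, φ γ ≠ m) : component φ m f = 0 := by
  ext γ
  rw [coeff_component]
  split_ifs with h'
  · by_contra h0
    exact h γ (by simpa using h0) h'
  · rfl

theorem mem_support_component {φ : Γ →+ L} {m : L} {f : AddMonoidAlgebra k Γ} {γ : Γ} :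
    γ ∈ (component φ m f).coeff.support ↔ γ ∈ f.coeff.support ∧ φ γ = m := by
  rw [Finsupp.mem_support_iff, coeff_component, Finsupp.mem_support_iff]
  split_ifs with h <;> simp [h]

theorem eq_sum_single (f : AddMonoidAlgebra k Γ) :
    f = ∑ γ ∈ f.coeff.support, single γ (f.coeff γ) :=
  (sum_coeff_single f).symm

theorem mul_eq_sum_single (f g : AddMonoidAlgebra k Γ) :
    f * g = ∑ x ∈ f.coeff.support, ∑ y ∈ g.coeff.support,
      single (x + y) (f.coeff x * g.coeff y) :=
  mul_def f g

/-- An exponent `x + y` of a product reaches degree `a + b` only when `x` and `y` both reach their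
bounds. -/
theorem component_mul (φ : Γ →+ L) {a b : L} {f g : AddMonoidAlgebra k Γ}
    (hf : ∀ γ ∈ f.coeff.support, φ γ ≤ a) (hg : ∀ γ ∈ g.coeff.support, φ γ ≤ b) :
    component φ (a + b) (f * g) = component φ a f * component φ b g := by
  conv_rhs => rw [eq_sum_single f, eq_sum_single g]
  rw [mul_eq_sum_single, component_sum, component_sum, component_sum, Finset.sum_mul_sum]
  refine Finset.sum_congr rfl fun x hx => ?_
  rw [component_sum]
  refine Finset.sum_congr rfl fun y hy => ?_
  simp only [component_single, map_add]
  have hx' := hf x hx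
  have hy' := hg y hy
  by_cases h1 : φ x = a
  · by_cases h2 : φ y = b
    · rw [if_pos (by rw [h1, h2]), if_pos h1, if_pos h2, single_mul_single]
    · rw [if_neg (by rw [h1]; simpa using h2), if_neg h2, mul_zero]
  · rw [if_neg (add_lt_add_of_lt_of_le (lt_of_le_of_ne hx' h1) hy').ne, if_neg h1, zero_mul]

/-- `m` is the largest `φ`-degree of an exponent of `f`. -/
structure IsTop (φ : Γ →+ L) (f : AddMonoidAlgebra k Γ) (m : L) : Prop where
  le : ∀ γ ∈ f.coeff.support, φ γ ≤ m
  attained : ∃ γ ∈ f.coeff.support, φ γ = m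

theorem exists_isTop (φ : Γ →+ L) {f : AddMonoidAlgebra k Γ} (hf : f ≠ 0) :
    ∃ m, IsTop φ f m := by
  have hne : f.coeff.support.Nonempty := by
    rw [Finsupp.support_nonempty_iff]
    simpa using hf
  obtain ⟨γ, hγ, h⟩ := Finset.exists_max_image _ φ hne
  exact ⟨φ γ, h, γ, hγ, rfl⟩

theorem IsTop.unique {φ : Γ →+ L} {f : AddMonoidAlgebra k Γ} {a b : L} (ha : IsTop φ f a)
    (hb : IsTop φ f b) : a = b := by
  obtain ⟨γ, hγ, rfl⟩ := ha.attained
  obtain ⟨γ', hγ', rfl⟩ := hb.attained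
  exact le_antisymm (hb.le _ hγ) (ha.le _ hγ')

theorem IsTop.component_ne_zero {φ : Γ →+ L} {f : AddMonoidAlgebra k Γ} {a : L}
    (ha : IsTop φ f a) : component φ a f ≠ 0 := by
  obtain ⟨γ, hγ, h⟩ := ha.attained
  intro h0
  have := mem_support_component.2 ⟨hγ, h⟩
  simp [h0] at this

theorem IsTop.of_subset {φ : Γ →+ L} {f g : AddMonoidAlgebra k Γ} {a b : L} (ha : IsTop φ f a)
    (hb : IsTop φ g b) (h : g.coeff.support ⊆ f.coeff.support) : b ≤ a := by
  obtain ⟨γ, hγ, rfl⟩ := hb.attained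
  exact ha.le _ (h hγ)

theorem support_component_subset (φ : Γ →+ L) (m : L) (f : AddMonoidAlgebra k Γ) :
    (component φ m f).coeff.support ⊆ f.coeff.support :=
  fun _ h => (mem_support_component.1 h).1

variable [NoZeroDivisors (AddMonoidAlgebra k Γ)]

/-- The candidate top part is the product of the two top parts, which cannot vanish in a domain. -/
theorem IsTop.mul {φ : Γ →+ L} {f g : AddMonoidAlgebra k Γ} {a b : L} (ha : IsTop φ f a)
    (hb : IsTop φ g b) : IsTop φ (f * g) (a + b) := by
  classical
  refine ⟨fun γ hγ => ?_, ?_⟩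
  · obtain ⟨x, hx, y, hy, rfl⟩ := Finset.mem_add.1 (support_coeff_mul_subset f g hγ)
    rw [map_add]
    exact add_le_add (ha.le x hx) (hb.le y hy)
  · by_contra! h
    have h0 := component_eq_zero φ (a + b) (f * g) h
    rw [component_mul φ ha.le hb.le] at h0
    exact mul_ne_zero ha.component_ne_zero hb.component_ne_zero h0

/-- All the exponents of `f` have the same `φ`-degree. -/
def IsHom (φ : Γ →+ L) (f : AddMonoidAlgebra k Γ) : Prop :=
  ∀ γ ∈ f.coeff.support, ∀ γ' ∈ f.coeff.support, φ γ = φ γ'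

theorem IsTop.neg_le {φ : Γ →+ L} {f : AddMonoidAlgebra k Γ} {a b : L} (ha : IsTop φ f a)
    (hb : IsTop (-φ) f b) : -b ≤ a := by
  obtain ⟨γ, hγ, rfl⟩ := hb.attained
  simpa using ha.le _ hγ

theorem IsHom.neg_eq {φ : Γ →+ L} {f : AddMonoidAlgebra k Γ} (h : IsHom φ f) {a b : L}
    (ha : IsTop φ f a) (hb : IsTop (-φ) f b) : -b = a := by
  obtain ⟨γ, hγ, rfl⟩ := ha.attained
  obtain ⟨γ', hγ', rfl⟩ := hb.attained
  simpa using h _ hγ' _ hγ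

theorem isHom_of_neg_eq {φ : Γ →+ L} {f : AddMonoidAlgebra k Γ} {a b : L}
    (ha : IsTop φ f a) (hb : IsTop (-φ) f b) (h : a ≤ -b) : IsHom φ f := by
  have key : ∀ γ ∈ f.coeff.support, φ γ = a := fun γ hγ => by
    refine le_antisymm (ha.le γ hγ) (h.trans ?_)
    simpa [neg_le] using hb.le γ hγ
  intro γ hγ γ' hγ'
  rw [key γ hγ, key γ' hγ']

/-- If the top part of `h * e` with respect to `ψ` has the same extreme `φ`-degrees as `h * e`, and
the top part of `h` is `φ`-homogeneous, then `h` is `φ`-homogeneous. -/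
theorem isHom_of_component {L' : Type*} [AddCommGroup L'] [LinearOrder L'] [IsOrderedAddMonoid L']
    {φ : Γ →+ L} {ψ : Γ →+ L'} {h e : AddMonoidAlgebra k Γ} {m m' : L} {a b : L'}
    (ha : IsTop ψ h a) (hb : IsTop ψ e b)
    (hm : ∀ γ ∈ (h * e).coeff.support, φ γ ≤ m)
    (hm' : ∀ γ ∈ (h * e).coeff.support, -φ γ ≤ m')
    (hc : ∃ γ ∈ (component ψ (a + b) (h * e)).coeff.support, φ γ = m)
    (hc' : ∃ γ ∈ (component ψ (a + b) (h * e)).coeff.support, -φ γ = m')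
    (hhom : IsHom φ (component ψ a h)) : IsHom φ h := by
  have hh : h ≠ 0 := by
    rintro rfl
    exact ha.component_ne_zero (component_zero _ _)
  have he : e ≠ 0 := by
    rintro rfl
    exact hb.component_ne_zero (component_zero _ _)
  have hprod := component_mul ψ ha.le hb.le
  have sub := support_component_subset (k := k) ψ
  -- The top `χ`-degrees of the `ψ`-top parts of `h` and `e` are at most those of `h` and `e`. Both
  -- pairs add up to `t`, so equality holds in each factor. Using this for `φ` and `-φ` compares the
  -- maximal and minimal degrees.
  have key : ∀ (χ : Γ →+ L) (t : L), (∀ γ ∈ (h * e).coeff.support, χ γ ≤ t) →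
      (∃ γ ∈ (component ψ (a + b) (h * e)).coeff.support, χ γ = t) →
      ∃ c, IsTop χ h c ∧ IsTop χ (component ψ a h) c := by
    intro χ t h1 ⟨γ, hγ, h2⟩
    obtain ⟨c, hc⟩ := exists_isTop χ hh
    obtain ⟨d, hd⟩ := exists_isTop χ he
    obtain ⟨c', hc'⟩ := exists_isTop χ ha.component_ne_zero
    obtain ⟨d', hd'⟩ := exists_isTop χ hb.component_ne_zero
    have t1 : IsTop χ (h * e) t := ⟨h1, γ, sub _ _ hγ, h2⟩
    have t2 : IsTop χ (component ψ (a + b) (h * e)) t :=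
      ⟨fun γ hγ => h1 γ (sub _ _ hγ), γ, hγ, h2⟩
    rw [hprod] at t2
    have e1 := t1.unique (hc.mul hd)
    have e2 := t2.unique (hc'.mul hd')
    have l1 := hc.of_subset hc' (sub _ _)
    have l2 := hd.of_subset hd' (sub _ _)
    have : c = c' := by
      by_contra hne
      have := add_lt_add_of_lt_of_le (lt_of_le_of_ne l1 (Ne.symm hne)) l2
      rw [← e1, ← e2] at this
      exact lt_irrefl _ this
    exact ⟨c, hc, this ▸ hc'⟩
  obtain ⟨c, hc1, hc2⟩ := key φ m hm hc
  obtain ⟨d, hd1, hd2⟩ := key (-φ) m' hm' hc'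
  exact isHom_of_neg_eq hc1 hd1 (hhom.neg_eq hc2 hd2).ge

/-- The width, largest minus smallest degree, is nonnegative and additive in products; if it
vanishes for the product, it vanishes for each factor. -/
theorem isHom_of_mul {φ : Γ →+ L} {h e : AddMonoidAlgebra k Γ} (h0 : h * e ≠ 0)
    (hhe : IsHom φ (h * e)) : IsHom φ h := by
  obtain ⟨a, ha⟩ := exists_isTop φ (left_ne_zero_of_mul h0)
  obtain ⟨b, hb⟩ := exists_isTop φ (right_ne_zero_of_mul h0)
  obtain ⟨a', ha'⟩ := exists_isTop (-φ) (left_ne_zero_of_mul h0)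
  obtain ⟨b', hb'⟩ := exists_isTop (-φ) (right_ne_zero_of_mul h0)
  have h1 := hhe.neg_eq (ha.mul hb) (ha'.mul hb')
  have h2 := ha.neg_le ha'
  have h3 := hb.neg_le hb'
  refine isHom_of_neg_eq ha ha' ?_
  by_contra hlt
  rw [not_le] at hlt
  have := add_lt_add_of_lt_of_le hlt h3
  rw [← h1, neg_add] at this
  exact lt_irrefl _ this

end Top

/-! ### Parallel vectors and collinear configurations -/

section Parallel

variable {n : ℕ}

/-- The integer vectors `u` and `d` are linearly dependent. -/
def Par (u d : Fin n → ℤ) : Prop :=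
  ∀ x y, u x * d y = u y * d x

theorem Par.sub {u u' d : Fin n → ℤ} (h : Par u d) (h' : Par u' d) : Par (u - u') d := by
  intro x y
  simp only [Pi.sub_apply, sub_mul, h x y, h' x y]

theorem Par.trans {u u' d : Fin n → ℤ} (hd : d ≠ 0) (h : Par u d) (h' : Par u' d) : Par u u' := by
  obtain ⟨z, hz⟩ := Function.ne_iff.1 hd
  rw [Pi.zero_apply] at hz
  intro x y
  refine mul_left_cancel₀ (mul_ne_zero hz hz) ?_
  linear_combination (d z * u' y) * h x z - (d z * u' x) * h y z + (u z * d x) * h' y z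
    - (u z * d y) * h' x z

/-- A finite family of lattice points lies on a line. -/
def Aligned {r : ℕ} (q : Fin r → Fin n → ℤ) : Prop :=
  ∀ a b c, Par (q b - q a) (q c - q a)

theorem aligned_of_par {r : ℕ} {q : Fin r → Fin n → ℤ} {d : Fin n → ℤ} (hd : d ≠ 0) {v : Fin r}
    (h : ∀ t, Par (q v - q t) d) : Aligned q := by
  intro a b c
  have h1 := (h a).sub (h b)
  have h2 := (h a).sub (h c)
  rw [sub_sub_sub_cancel_left] at h1 h2
  exact Par.trans hd h1 h2

/-- A non-aligned configuration of at least four points has a vertex whose removal leaves a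
non-aligned configuration. -/
theorem exists_vertex {r : ℕ} {q : Fin (r + 3) → Fin n → ℤ} (hq : Function.Injective q)
    (hal : ¬ Aligned q) :
    ∃ (v : Fin (r + 3)) (ℓ : (Fin n → ℤ) →+ Lex (Fin n → ℤ)),
      (∀ a, a ≠ v → ℓ (q a) < ℓ (q v)) ∧ (r = 0 ∨ ¬ Aligned fun a => q (v.succAbove a)) := by
  let ℓ : (Fin n → ℤ) →+ Lex (Fin n → ℤ) := (toLexAddEquiv (Fin n → ℤ)).toAddMonoidHom
  have hℓ : Function.Injective ℓ := (toLexAddEquiv (Fin n → ℤ)).injective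
  obtain ⟨M, hM⟩ := Finite.exists_max fun a => ℓ (q a)
  obtain ⟨m, hm⟩ := Finite.exists_min fun a => ℓ (q a)
  -- The lexicographic order is total on the lattice, so the maximum `M` and the minimum `m` are
  -- unique vertices, exposed by `ℓ` and `-ℓ`.
  have hM' : ∀ a, a ≠ M → ℓ (q a) < ℓ (q M) := fun a ha =>
    lt_of_le_of_ne (hM a) fun h => ha (hq (hℓ h))
  have hm' : ∀ a, a ≠ m → (-ℓ) (q a) < (-ℓ) (q m) := fun a ha => by
    exact neg_lt_neg (lt_of_le_of_ne (hm a) fun h => ha (hq (hℓ h)).symm)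
  rcases Nat.eq_zero_or_pos r with hr | hr
  · exact ⟨M, ℓ, hM', Or.inl hr⟩
  by_cases h1 : Aligned fun a => q (M.succAbove a)
  swap
  · exact ⟨M, ℓ, hM', Or.inr h1⟩
  by_cases h2 : Aligned fun a => q (m.succAbove a)
  swap
  · exact ⟨m, -ℓ, hm', Or.inr h2⟩
  exfalso
  -- With at least four points there are two others, `a` and `b`. If removing `M` and removing `m`
  -- both leave collinear points, the line through `a` and `b` contains everything.
  have hcard : 1 < (({M, m} : Finset (Fin (r + 3)))ᶜ).card := by
    rw [Finset.card_compl, Fintype.card_fin]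
    have := Finset.card_le_two (a := M) (b := m)
    omega
  obtain ⟨a, ha, b, hb, hab⟩ := Finset.one_lt_card.1 hcard
  simp only [Finset.mem_compl, Finset.mem_insert, Finset.mem_singleton, not_or] at ha hb
  have key : ∀ v, (Aligned fun a => q (v.succAbove a)) → a ≠ v → b ≠ v → ∀ x, x ≠ v →
      Par (q a - q x) (q a - q b) := by
    intro v hv hav hbv x hx
    obtain ⟨a', rfl⟩ := Fin.exists_succAbove_eq hav
    obtain ⟨b', rfl⟩ := Fin.exists_succAbove_eq hbv
    obtain ⟨x', rfl⟩ := Fin.exists_succAbove_eq hx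
    intro y z
    have := hv a' x' b' y z
    simp only [Pi.sub_apply] at this ⊢
    linear_combination this
  refine hal (aligned_of_par (d := q a - q b) (v := a) (sub_ne_zero.2 (hq.ne hab)) fun x => ?_)
  by_cases hx : x = M
  · by_cases hx' : x = m
    · exfalso
      have h3 := hm a
      have h4 := hM' a ha.1
      rw [← hx', hx] at h3
      exact absurd h4 (not_lt.2 h3)
    · exact key m h2 ha.2 hb.2 x hx'
  · exact key M h1 ha.1 hb.1 x hx

end Parallel

/-! ### Generalised Vandermonde determinants -/

section Vandermonde

variable {k : Type*} [Field k] {ι : Type*} [Fintype ι] [DecidableEq ι] {n : ℕ}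

/-- The monomial `x_i ^ q`. -/
def mono (k : Type*) [Field k] {ι : Type*} [DecidableEq ι] {n : ℕ} (i : ι) (q : Fin n → ℤ) :
    AddMonoidAlgebra k (ι → Fin n → ℤ) :=
  single (Pi.single i q) 1

/-- The determinant of the matrix with entries `x_{c i} ^ (q j)`. -/
def vdm (k : Type*) [Field k] {ι : Type*} [DecidableEq ι] {n r : ℕ} (q : Fin r → Fin n → ℤ)
    (c : Fin r → ι) : AddMonoidAlgebra k (ι → Fin n → ℤ) :=
  Matrix.det (Matrix.of fun j i => mono k (c i) (q j))

/-- The exponent of the term of `vdm k q c` given by the permutation `σ`. -/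
def expo {r : ℕ} (q : Fin r → Fin n → ℤ) (c : Fin r → ι) (σ : Fin r → Fin r) : ι → Fin n → ℤ :=
  ∑ i, Pi.single (c i) (q (σ i))

theorem prod_mono {α : Type*} (s : Finset α) (c : α → ι) (q : α → Fin n → ℤ) :
    ∏ i ∈ s, mono k (c i) (q i) = single (∑ i ∈ s, Pi.single (c i) (q i)) 1 := by
  classical
  induction s using Finset.induction_on with
  | empty => rfl
  | insert a s ha ih => rw [Finset.prod_insert ha, Finset.sum_insert ha, ih, mono,
      single_mul_single, one_mul]

theorem vdm_eq_sum {r : ℕ} (q : Fin r → Fin n → ℤ) (c : Fin r → ι) :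
    vdm k q c = ∑ σ : Equiv.Perm (Fin r), Equiv.Perm.sign σ • single (expo q c σ) (1 : k) := by
  rw [vdm, Matrix.det_apply]
  refine Finset.sum_congr rfl fun σ _ => ?_
  simp only [Matrix.of_apply]
  rw [prod_mono Finset.univ c fun i => q (σ i)]
  rfl

theorem expo_apply {r : ℕ} (q : Fin r → Fin n → ℤ) {c : Fin r → ι} (hc : Function.Injective c)
    (σ : Fin r → Fin r) (i : Fin r) : expo q c σ (c i) = q (σ i) := by
  rw [expo, Finset.sum_apply, Finset.sum_eq_single i]
  · simp
  · intro j _ hj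
    rw [Pi.single_eq_of_ne (hc.ne hj.symm)]
  · simp

theorem expo_apply_of_notMem {r : ℕ} (q : Fin r → Fin n → ℤ) {c : Fin r → ι} {j : ι}
    (hj : j ∉ Set.range c) (σ : Fin r → Fin r) : expo q c σ j = 0 := by
  rw [expo, Finset.sum_apply]
  refine Finset.sum_eq_zero fun i _ => ?_
  rw [Pi.single_eq_of_ne]
  rintro rfl
  exact hj ⟨i, rfl⟩

theorem expo_injective {r : ℕ} {q : Fin r → Fin n → ℤ} (hq : Function.Injective q)
    {c : Fin r → ι} (hc : Function.Injective c) :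
    Function.Injective fun σ : Equiv.Perm (Fin r) => expo q c σ := by
  intro σ τ h
  ext i
  have := congrFun h (c i)
  simp only [expo_apply q hc] at this
  rw [hq this]

theorem coeff_vdm {r : ℕ} {q : Fin r → Fin n → ℤ} (hq : Function.Injective q)
    {c : Fin r → ι} (hc : Function.Injective c) (σ : Equiv.Perm (Fin r)) :
    (vdm k q c).coeff (expo q c σ) = Equiv.Perm.sign σ • (1 : k) := by
  rw [vdm_eq_sum, coeff_sum, Finsupp.finsetSum_apply, Finset.sum_eq_single σ]
  · simp
  · intro τ _ hτ
    have : expo q c τ ≠ expo q c σ := (expo_injective hq hc).ne hτ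
    simp [this]
  · simp

theorem expo_mem_support {r : ℕ} {q : Fin r → Fin n → ℤ} (hq : Function.Injective q)
    {c : Fin r → ι} (hc : Function.Injective c) (σ : Equiv.Perm (Fin r)) :
    expo q c σ ∈ (vdm k q c).coeff.support := by
  rw [Finsupp.mem_support_iff, coeff_vdm hq hc]
  rcases Int.units_eq_one_or (Equiv.Perm.sign σ) with h | h <;> simp [h]

theorem exists_of_mem_support_vdm {r : ℕ} {q : Fin r → Fin n → ℤ} {c : Fin r → ι}
    {γ : ι → Fin n → ℤ} (h : γ ∈ (vdm k q c).coeff.support) :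
    ∃ σ : Equiv.Perm (Fin r), γ = expo q c σ := by
  by_contra! h'
  rw [Finsupp.mem_support_iff, vdm_eq_sum, coeff_sum, Finsupp.finsetSum_apply] at h
  refine h (Finset.sum_eq_zero fun σ _ => ?_)
  simp [(h' σ).symm]

theorem vdm_ne_zero {r : ℕ} {q : Fin r → Fin n → ℤ} (hq : Function.Injective q)
    {c : Fin r → ι} (hc : Function.Injective c) : vdm k q c ≠ 0 := by
  intro h
  have := expo_mem_support (k := k) hq hc 1
  simp [h] at this

theorem vdm_succ {r : ℕ} (q : Fin (r + 1) → Fin n → ℤ) (c : Fin (r + 1) → ι) (j : Fin (r + 1)) :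
    vdm k q c = ∑ a : Fin (r + 1), (-1) ^ ((a : ℕ) + (j : ℕ)) * mono k (c j) (q a) *
      vdm k (fun b => q (a.succAbove b)) (fun b => c (j.succAbove b)) :=
  Matrix.det_succ_column _ j

theorem neg_one_pow_mul_eq (s : ℕ) (f : AddMonoidAlgebra k (ι → Fin n → ℤ)) :
    (-1) ^ s * f = f ∨ (-1) ^ s * f = -f := by
  rcases neg_one_pow_eq_or (AddMonoidAlgebra k (ι → Fin n → ℤ)) s with h | h <;> simp [h]

theorem mem_support_vdm_succ_term {r : ℕ} {q : Fin (r + 1) → Fin n → ℤ}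
    {c : Fin (r + 1) → ι} (hc : Function.Injective c) {j a : Fin (r + 1)} {γ : ι → Fin n → ℤ}
    (hγ : γ ∈ ((-1) ^ ((a : ℕ) + (j : ℕ)) * mono k (c j) (q a) *
      vdm k (fun b => q (a.succAbove b)) (fun b => c (j.succAbove b))).coeff.support) :
    γ (c j) = q a := by
  have hγ' : γ ∈ (mono k (c j) (q a) *
      vdm k (fun b => q (a.succAbove b)) (fun b => c (j.succAbove b))).coeff.support := by
    rw [mul_assoc] at hγ
    rcases neg_one_pow_mul_eq ((a : ℕ) + (j : ℕ)) (mono k (c j) (q a) *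
      vdm k (fun b => q (a.succAbove b)) (fun b => c (j.succAbove b))) with h | h
    · rwa [h] at hγ
    · rw [h] at hγ
      simpa using hγ
  have h2 := support_coeff_mul_subset _ _ hγ'
  obtain ⟨x, hx, y, hy, rfl⟩ := Finset.mem_add.1 h2
  obtain ⟨σ, rfl⟩ := exists_of_mem_support_vdm hy
  have hx' : x = Pi.single (c j) (q a) := by
    by_contra hne
    rw [mono, Finsupp.mem_support_iff, coeff_single, Finsupp.single_apply, if_neg (Ne.symm hne)] at hx
    exact hx rfl
  rw [Pi.add_apply, expo_apply_of_notMem, hx']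
  · simp
  · rintro ⟨b, hb⟩
    exact Fin.succAbove_ne j b (hc hb)

/-- The homomorphism that sends an exponent to its component at the variable `x_i`, followed by
`w`. -/
def coordHom {L : Type*} [AddCommGroup L] (i : ι) (w : (Fin n → ℤ) →+ L) :
    (ι → Fin n → ℤ) →+ L :=
  w.comp (Pi.evalAddMonoidHom (fun _ : ι => Fin n → ℤ) i)

@[simp]
theorem coordHom_apply {L : Type*} [AddCommGroup L] (i : ι) (w : (Fin n → ℤ) →+ L)
    (γ : ι → Fin n → ℤ) : coordHom i w γ = w (γ i) := rfl

/-- In the Laplace expansion along the column of `x_{c j}`, the summand of `a` has exponent `q a` at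
that variable, so only the summand of the exposed vertex reaches the top. -/
theorem component_vdm {L : Type*} [AddCommGroup L] [LinearOrder L] [IsOrderedAddMonoid L] {r : ℕ}
    {q : Fin (r + 1) → Fin n → ℤ} {c : Fin (r + 1) → ι} (hc : Function.Injective c)
    (ℓ : (Fin n → ℤ) →+ L) (j v : Fin (r + 1)) (hv : ∀ a, a ≠ v → ℓ (q a) < ℓ (q v)) :
    component (coordHom (c j) ℓ) (ℓ (q v)) (vdm k q c) =
      (-1) ^ ((v : ℕ) + (j : ℕ)) * mono k (c j) (q v) *
        vdm k (fun b => q (v.succAbove b)) (fun b => c (j.succAbove b)) := by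
  rw [vdm_succ q c j, component_sum, Finset.sum_eq_single v]
  · refine component_eq_self _ _ _ fun γ hγ => ?_
    rw [coordHom_apply, mem_support_vdm_succ_term hc hγ]
  · intro a _ ha
    refine component_eq_zero _ _ _ fun γ hγ => ?_
    rw [coordHom_apply, mem_support_vdm_succ_term hc hγ]
    exact (hv a ha).ne
  · simp

theorem isUnit_mono (i : ι) (q : Fin n → ℤ) : IsUnit (mono k i q) := by
  refine IsUnit.of_mul_eq_one (mono k i (-q)) ?_
  rw [mono, mono, single_mul_single, ← Pi.single_add, add_neg_cancel, Pi.single_zero, one_mul]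
  rfl

theorem isTop_vdm {L : Type*} [AddCommGroup L] [LinearOrder L] [IsOrderedAddMonoid L] {r : ℕ}
    {q : Fin r → Fin n → ℤ} (hq : Function.Injective q) {c : Fin r → ι}
    (hc : Function.Injective c) (ℓ : (Fin n → ℤ) →+ L) (j v : Fin r)
    (hv : ∀ a, ℓ (q a) ≤ ℓ (q v)) : IsTop (coordHom (c j) ℓ) (vdm k q c) (ℓ (q v)) := by
  refine ⟨fun γ hγ => ?_, expo q c (Equiv.swap j v), expo_mem_support hq hc _, ?_⟩
  · obtain ⟨σ, rfl⟩ := exists_of_mem_support_vdm hγ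
    rw [coordHom_apply, expo_apply q hc]
    exact hv _
  · rw [coordHom_apply, expo_apply q hc, Equiv.swap_apply_left]

/-- All the exponents of `f` have the same component at `x_i`. -/
def ConstAt (f : AddMonoidAlgebra k (ι → Fin n → ℤ)) (i : ι) : Prop :=
  ∀ γ ∈ f.coeff.support, ∀ γ' ∈ f.coeff.support, γ i = γ' i

theorem ConstAt.of_mul {h e : AddMonoidAlgebra k (ι → Fin n → ℤ)} (h0 : h * e ≠ 0) {i : ι}
    (hc : ConstAt (h * e) i) : ConstAt h i := by
  intro γ hγ γ' hγ'
  funext x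
  refine isHom_of_mul (φ := coordHom i (Pi.evalAddMonoidHom (fun _ : Fin n => ℤ) x)) h0 ?_
    γ hγ γ' hγ'
  intro δ hδ δ' hδ'
  rw [coordHom_apply, coordHom_apply, hc δ hδ δ' hδ']

theorem constAt_vdm_of_notMem {r : ℕ} {q : Fin r → Fin n → ℤ} {c : Fin r → ι} {i : ι}
    (hi : i ∉ Set.range c) : ConstAt (vdm k q c) i := by
  intro γ hγ γ' hγ'
  obtain ⟨σ, rfl⟩ := exists_of_mem_support_vdm hγ
  obtain ⟨τ, rfl⟩ := exists_of_mem_support_vdm hγ'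
  rw [expo_apply_of_notMem q hi, expo_apply_of_notMem q hi]

theorem exists_perm_two {r : ℕ} {i j a v : Fin r} (hij : i ≠ j) (hav : a ≠ v) :
    ∃ σ : Equiv.Perm (Fin r), σ i = a ∧ σ j = v := by
  refine ⟨Equiv.swap (Equiv.swap j v i) a * Equiv.swap j v, ?_, ?_⟩
  · simp
  · rw [Equiv.Perm.mul_apply, Equiv.swap_apply_left, Equiv.swap_apply_of_ne_of_ne _ hav.symm]
    intro h
    exact hij ((Equiv.swap j v).injective (h.symm.trans (Equiv.swap_apply_left j v).symm))

/-- The functional `d ↦ u x * d y - u y * d x`. -/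
def minorHom (u : Fin n → ℤ) (x y : Fin n) : (Fin n → ℤ) →+ ℤ where
  toFun d := u x * d y - u y * d x
  map_zero' := by simp
  map_add' a b := by simp only [Pi.add_apply]; ring

theorem minorHom_apply (u : Fin n → ℤ) (x y : Fin n) (d : Fin n → ℤ) :
    minorHom u x y d = u x * d y - u y * d x := rfl

/-- A divisor of a generalised Vandermonde determinant of a non-aligned configuration that is
homogeneous in one of the variables is a monomial. -/
theorem subsingleton_of_mul_eq_vdm {r : ℕ} {q : Fin (r + 2) → Fin n → ℤ}
    (hq : Function.Injective q) (hal : r = 0 ∨ ¬ Aligned q) {c : Fin (r + 2) → ι}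
    (hc : Function.Injective c) {h e : AddMonoidAlgebra k (ι → Fin n → ℤ)}
    (hhe : h * e = vdm k q c) {b : Fin (r + 2)} (hb : ConstAt h (c b)) :
    ∀ i, ConstAt h i := by
  induction r generalizing h e with
  | zero =>
    let ℓ : (Fin n → ℤ) →+ Lex (Fin n → ℤ) := (toLexAddEquiv (Fin n → ℤ)).toAddMonoidHom
    have hℓ : Function.Injective ℓ := (toLexAddEquiv (Fin n → ℤ)).injective
    obtain ⟨v, hv⟩ := Finite.exists_max fun a => ℓ (q a)
    have h0 : h * e ≠ 0 := hhe ▸ vdm_ne_zero hq hc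
    obtain ⟨s, hs⟩ := exists_isTop (coordHom (c b) ℓ) (left_ne_zero_of_mul h0)
    obtain ⟨t, ht⟩ := exists_isTop (coordHom (c b) ℓ) (right_ne_zero_of_mul h0)
    have hst := (hs.mul ht).unique (hhe ▸ isTop_vdm hq hc ℓ b v hv)
    have h1 := component_mul _ hs.le ht.le
    -- Since `h` is constant at `x_{c b}`, it is its own top part and divides the top part of the
    -- determinant. For two points that top part is a single monomial, because a permutation of two
    -- letters is determined by one value.
    have h2 : component (coordHom (c b) ℓ) s h = h := by
      refine component_eq_self _ _ _ fun γ hγ => ?_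
      obtain ⟨γ', hγ', rfl⟩ := hs.attained
      rw [coordHom_apply, coordHom_apply, hb γ hγ γ' hγ']
    rw [h2] at h1
    have hne : h * component (coordHom (c b) ℓ) t e ≠ 0 :=
      mul_ne_zero (left_ne_zero_of_mul h0) ht.component_ne_zero
    rw [hst, hhe] at h1
    intro i
    refine ConstAt.of_mul hne ?_
    rw [← h1]
    intro γ hγ γ' hγ'
    obtain ⟨hγ1, hγ2⟩ := mem_support_component.1 hγ
    obtain ⟨hγ1', hγ2'⟩ := mem_support_component.1 hγ'
    obtain ⟨σ, rfl⟩ := exists_of_mem_support_vdm hγ1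
    obtain ⟨τ, rfl⟩ := exists_of_mem_support_vdm hγ1'
    rw [coordHom_apply, expo_apply q hc] at hγ2 hγ2'
    have hστ : σ b = τ b := hq (hℓ (hγ2.trans hγ2'.symm))
    have key : ∀ σ τ : Equiv.Perm (Fin 2), ∀ b, σ b = τ b → σ = τ := by decide
    rw [key σ τ b hστ]
  | succ r ih =>
    have hal' : ¬ Aligned q := hal.resolve_left (Nat.succ_ne_zero r)
    have h0 : h * e ≠ 0 := hhe ▸ vdm_ne_zero hq hc
    obtain ⟨v, ℓ, hv, hvr⟩ := exists_vertex hq hal'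
    intro i
    by_cases hi : i ∈ Set.range c
    swap
    · exact ConstAt.of_mul h0 (hhe ▸ constAt_vdm_of_notMem hi)
    obtain ⟨i, rfl⟩ := hi
    by_cases hib : i = b
    · rwa [hib]
    -- Top parts are taken in a third variable: `j ≠ b` keeps the homogeneity at `x_{c b}` available
    -- for the induction, and `j ≠ i` leaves the exponent at `x_{c i}` free.
    obtain ⟨j, hj⟩ : ∃ j : Fin (r + 3), j ∉ ({i, b} : Finset (Fin (r + 3))) := by
      by_contra! hall
      have h1 := Finset.card_le_card (fun x _ => hall x : Finset.univ ⊆ _)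
      have h2 := Finset.card_le_two (a := i) (b := b)
      rw [Finset.card_univ, Fintype.card_fin] at h1
      omega
    simp only [Finset.mem_insert, Finset.mem_singleton, not_or] at hj
    obtain ⟨s, hs⟩ := exists_isTop (coordHom (c j) ℓ) (left_ne_zero_of_mul h0)
    obtain ⟨t, ht⟩ := exists_isTop (coordHom (c j) ℓ) (right_ne_zero_of_mul h0)
    have hv' : ∀ a, ℓ (q a) ≤ ℓ (q v) := fun a => by
      by_cases ha : a = v
      · rw [ha]
      · exact (hv a ha).le
    have hst := (hs.mul ht).unique (hhe ▸ isTop_vdm hq hc ℓ j v hv')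
    have h1 := component_mul _ hs.le ht.le
    rw [hst, hhe, component_vdm hc ℓ j v hv] at h1
    have hu : IsUnit ((-1) ^ ((v : ℕ) + (j : ℕ)) * mono k (c j) (q v)) :=
      ((isUnit_one.neg).pow _).mul (isUnit_mono _ _)
    obtain ⟨u, hu'⟩ := hu.exists_left_inv
    obtain ⟨b', rfl⟩ := Fin.exists_succAbove_eq (Ne.symm hj.2)
    -- Up to a unit, the top part of `h` divides the determinant of the configuration without `v`,
    -- so induction makes it a monomial.
    have hconst : ∀ i, ConstAt (component (coordHom (c j) ℓ) s h) i := by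
      refine ih (q := fun a => q (v.succAbove a)) (hq.comp Fin.succAbove_right_injective) hvr
        (c := fun a => c (j.succAbove a)) (hc.comp Fin.succAbove_right_injective)
        (e := component (coordHom (c j) ℓ) t e * u) ?_ (b := b') ?_
      · rw [← mul_assoc, ← h1, mul_comm, ← mul_assoc, hu', one_mul]
      · intro γ hγ γ' hγ'
        exact hb γ (support_component_subset _ _ _ hγ) γ' (support_component_subset _ _ _ hγ')
    intro γ hγ γ' hγ'
    by_contra hne
    -- If `h` had exponents differing at `x_{c i}`, their difference would be parallel to `q v - q
    -- t'` for every `t'`, and all the points would be collinear.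
    refine hal' (aligned_of_par (sub_ne_zero.2 hne) (v := v) fun t' => ?_)
    by_cases htv : t' = v
    · intro x y
      simp [htv]
    intro x y
    let w := minorHom (q v - q t') x y
    have hw : w (q v) = w (q t') := by
      rw [← sub_eq_zero, ← map_sub, minorHom_apply]
      ring
    -- As `w` takes the same value at `v` and `t'`, its maximum and minimum over the points are
    -- attained away from `v`. Hence passing to the `x_{c j}`-top part, which fixes `v` at `x_{c
    -- j}`, does not change the extreme `w`-degrees at `x_{c i}`.
    have extreme : ∀ w' : (Fin n → ℤ) →+ ℤ, w' (q v) = w' (q t') →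
        ∃ a, a ≠ v ∧ ∀ a', w' (q a') ≤ w' (q a) := by
      intro w' hw'
      obtain ⟨a, ha⟩ := Finite.exists_max fun a => w' (q a)
      by_cases hav : a = v
      · exact ⟨t', htv, fun a' => by rw [← hw', ← hav]; exact ha a'⟩
      · exact ⟨a, hav, ha⟩
    have att : ∀ a, a ≠ v → ∃ σ : Equiv.Perm (Fin (r + 3)), σ i = a ∧
        expo q c σ ∈ (component (coordHom (c j) ℓ) (s + t) (h * e)).coeff.support := by
      intro a ha
      obtain ⟨σ, hσ, hσ'⟩ := exists_perm_two (Ne.symm hj.1) ha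
      refine ⟨σ, hσ, mem_support_component.2 ⟨hhe ▸ expo_mem_support hq hc σ, ?_⟩⟩
      rw [coordHom_apply, expo_apply q hc, hσ', hst]
    have bound : ∀ (w' : (Fin n → ℤ) →+ ℤ) (a : Fin (r + 3)), (∀ a', w' (q a') ≤ w' (q a)) →
        ∀ γ ∈ (h * e).coeff.support, w' (γ (c i)) ≤ w' (q a) := by
      intro w' a ha γ hγ
      rw [hhe] at hγ
      obtain ⟨σ, rfl⟩ := exists_of_mem_support_vdm hγ
      rw [expo_apply q hc]
      exact ha _
    obtain ⟨a, hav, ha⟩ := extreme w hw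
    obtain ⟨a', hav', ha'⟩ := extreme (-w) (by simp [hw])
    obtain ⟨σ, hσ, hσ'⟩ := att a hav
    obtain ⟨τ, hτ, hτ'⟩ := att a' hav'
    have hhom : IsHom (coordHom (c i) w) h := by
      refine isHom_of_component hs ht (m := w (q a)) (m' := (-w) (q a')) (bound w a ha)
        (bound (-w) a' ha') ⟨_, hσ', ?_⟩ ⟨_, hτ', ?_⟩ ?_
      · rw [coordHom_apply, expo_apply q hc, hσ]
      · rw [coordHom_apply, expo_apply q hc, hτ]
        rfl
      · intro δ hδ δ' hδ'
        rw [coordHom_apply, coordHom_apply, hconst (c i) δ hδ δ' hδ']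
    have := hhom γ hγ γ' hγ'
    rw [coordHom_apply, coordHom_apply, ← sub_eq_zero, ← map_sub, minorHom_apply] at this
    linarith

end Vandermonde

/-! ### Laurent polynomials form a unique factorization domain -/

section UFD

variable (k : Type*) [Field k] (ι : Type*) [Finite ι] (n : ℕ)

/-- The exponents of polynomials as exponents of Laurent polynomials. -/
def natExpo : ((ι × Fin n) →₀ ℕ) →+ (ι → Fin n → ℤ) where
  toFun m i x := m (i, x)
  map_zero' := by ext; simp
  map_add' a b := by ext; simp

theorem natExpo_injective : Function.Injective (natExpo ι n) := by
  intro a b h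
  ext ⟨i, x⟩
  have := congrFun (congrFun h i) x
  simpa [natExpo] using this

/-- The inclusion of polynomials into Laurent polynomials. -/
def polyHom : MvPolynomial (ι × Fin n) k →+* AddMonoidAlgebra k (ι → Fin n → ℤ) :=
  mapDomainRingHom k (natExpo ι n)

theorem polyHom_monomial (m : (ι × Fin n) →₀ ℕ) (a : k) :
    polyHom k ι n (MvPolynomial.monomial m a) = single (natExpo ι n m) a :=
  mapDomain_single

theorem polyHom_injective : Function.Injective (polyHom k ι n) :=
  mapDomain_injective (natExpo_injective ι n)

/-- The submonoid of monomials. -/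
def monomials : Submonoid (MvPolynomial (ι × Fin n) k) where
  carrier := {f | ∃ m, f = MvPolynomial.monomial m 1}
  one_mem' := ⟨0, rfl⟩
  mul_mem' := by
    rintro _ _ ⟨a, rfl⟩ ⟨b, rfl⟩
    exact ⟨a + b, by rw [MvPolynomial.monomial_mul, one_mul]⟩

theorem isUnit_single {Γ : Type*} [AddCommGroup Γ] {γ : Γ} {a : k} (ha : a ≠ 0) :
    IsUnit (single γ a : AddMonoidAlgebra k Γ) := by
  refine IsUnit.of_mul_eq_one (single (-γ) a⁻¹) ?_
  rw [single_mul_single, add_neg_cancel, mul_inv_cancel₀ ha]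
  rfl

theorem exists_mul_polyHom_eq (f : AddMonoidAlgebra k (ι → Fin n → ℤ)) :
    ∃ (s : monomials k ι n) (g : MvPolynomial (ι × Fin n) k),
      f * polyHom k ι n s = polyHom k ι n g := by
  induction f using AddMonoidAlgebra.induction_linear with
  | zero => exact ⟨1, 0, by simp⟩
  | add f f' hf hf' =>
    obtain ⟨s, g, h⟩ := hf
    obtain ⟨s', g', h'⟩ := hf'
    refine ⟨s * s', g * s' + g' * s, ?_⟩
    rw [Submonoid.coe_mul, map_mul, map_add, map_mul, map_mul, ← h, ← h']
    ring
  | single γ a =>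
    -- Split `γ` into its positive and negative parts.
    refine ⟨⟨MvPolynomial.monomial (Finsupp.equivFunOnFinite.symm fun z => (-γ z.1 z.2).toNat) 1,
      _, rfl⟩, MvPolynomial.monomial (Finsupp.equivFunOnFinite.symm fun z => (γ z.1 z.2).toNat) a,
      ?_⟩
    rw [polyHom_monomial, polyHom_monomial, single_mul_single, mul_one]
    congr 1
    funext i x
    simp only [natExpo, Pi.add_apply, AddMonoidHom.coe_mk, ZeroHom.coe_mk,
      Finsupp.equivFunOnFinite_symm_apply_apply]
    omega

/-- Laurent polynomials are the localization of a polynomial ring at the monomials, and localization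
preserves unique factorization. -/
instance : UniqueFactorizationMonoid (AddMonoidAlgebra k (ι → Fin n → ℤ)) := by
  let _ : Algebra (MvPolynomial (ι × Fin n) k) (AddMonoidAlgebra k (ι → Fin n → ℤ)) :=
    (polyHom k ι n).toAlgebra
  have : IsLocalization (monomials k ι n) (AddMonoidAlgebra k (ι → Fin n → ℤ)) := by
    refine ⟨?_, ?_, ?_⟩
    · rintro ⟨_, m, rfl⟩
      change IsUnit (polyHom k ι n _)
      rw [polyHom_monomial]
      exact isUnit_single k one_ne_zero
    · intro f
      obtain ⟨s, g, h⟩ := exists_mul_polyHom_eq k ι n f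
      exact ⟨(g, s), h⟩
    · intro f g h
      exact ⟨1, by rw [polyHom_injective k ι n h]⟩
  exact UniqueFactorizationMonoid.of_isLocalization (monomials k ι n) _

theorem isUnit_of_constAt {f : AddMonoidAlgebra k (ι → Fin n → ℤ)} (hf : f ≠ 0)
    (h : ∀ i, ConstAt f i) : IsUnit f := by
  classical
  obtain ⟨γ, hγ⟩ := Finsupp.support_nonempty_iff.2 (mt coeff_eq_zero.1 hf)
  have : f = single γ (f.coeff γ) := by
    ext δ
    by_cases hδ : γ = δ
    · subst hδ
      simp
    · by_contra hne
      rw [coeff_single, Finsupp.single_apply, if_neg hδ] at hne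
      exact hδ (funext fun i => h i γ hγ δ (Finsupp.mem_support_iff.2 hne))
  rw [this]
  exact isUnit_single k (Finsupp.mem_support_iff.1 hγ)

end UFD

/-! ### Divisibility by the generalised Vandermonde determinant -/

section Divisibility

variable {k : Type*} [Field k] {n : ℕ}

theorem vdm_dvd {r : ℕ} {q : Fin (r + 2) → Fin n → ℤ} (hq : Function.Injective q)
    (hal : r = 0 ∨ ¬ Aligned q) (F : Fin (r + 2) → AddMonoidAlgebra k (Fin (r + 2) → Fin n → ℤ))
    (hF : ∀ i : Fin (r + 1), ∑ j, F j * mono k i.castSucc (q j) = 0) :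
    vdm k q id ∣ ∑ j, F j * mono k (Fin.last (r + 1)) (q j) := by
  set f := ∑ j, F j * mono k (Fin.last (r + 1)) (q j) with hf
  let M : Matrix (Fin (r + 2)) (Fin (r + 2)) (AddMonoidAlgebra k (Fin (r + 2) → Fin n → ℤ)) :=
    Matrix.of fun j i => mono k i (q j)
  have hM : Matrix.vecMul F M = Pi.single (Fin.last (r + 1)) f := by
    funext i
    change ∑ j, F j * mono k i (q j) = _
    induction i using Fin.lastCases with
    | last => rw [Pi.single_eq_same]
    | cast i => rw [hF, Pi.single_eq_of_ne (Fin.castSucc_ne_last i)]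
  -- The index `0` is an arbitrary choice: each cofactor of the last column avoids the last
  -- variable.
  let C := M.adjugate (Fin.last (r + 1)) 0
  have h1 : f * C = vdm k q id * F 0 := by
    have h2 := congrArg (fun v => Matrix.vecMul v M.adjugate 0) hM
    simp only [Matrix.vecMul_vecMul, Matrix.mul_adjugate, Matrix.single_vecMul] at h2
    rw [Matrix.vecMul_smul, Matrix.vecMul_one] at h2
    exact h2.symm
  have hCv : C = (-1) ^ (((0 : Fin (r + 2)) : ℕ) + (Fin.last (r + 1) : ℕ)) *
      vdm k (fun b => q ((0 : Fin (r + 2)).succAbove b)) (fun b => (Fin.last (r + 1)).succAbove b) :=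
    Matrix.adjugate_fin_succ_eq_det_submatrix M (Fin.last (r + 1)) 0
  have hV0 : vdm k (fun b => q ((0 : Fin (r + 2)).succAbove b))
      (fun b => (Fin.last (r + 1)).succAbove b) ≠ 0 :=
    vdm_ne_zero (hq.comp Fin.succAbove_right_injective) Fin.succAbove_right_injective
  have hC0 : C ≠ 0 := by
    rw [hCv]
    exact mul_ne_zero (pow_ne_zero _ (neg_ne_zero.2 one_ne_zero)) hV0
  have hCc : ConstAt C (Fin.last (r + 1)) := by
    have h3 := constAt_vdm_of_notMem (k := k) (q := fun b => q ((0 : Fin (r + 2)).succAbove b))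
      (c := fun b => (Fin.last (r + 1)).succAbove b) (i := Fin.last (r + 1)) (by
        rintro ⟨b, hb⟩
        exact Fin.succAbove_ne _ b hb)
    rw [hCv]
    rcases neg_one_pow_mul_eq (((0 : Fin (r + 2)) : ℕ) + (Fin.last (r + 1) : ℕ))
      (vdm k (fun b => q ((0 : Fin (r + 2)).succAbove b))
      (fun b => (Fin.last (r + 1)).succAbove b)) with h | h
    · rwa [h]
    · rw [h]
      intro γ hγ γ' hγ'
      exact h3 γ (by simpa using hγ) γ' (by simpa using hγ')
  obtain ⟨f', d, u, hrel, hf', hd⟩ := UniqueFactorizationMonoid.exists_reduced_factors' (F 0) C hC0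
  have hu0 : u ≠ 0 := by
    rintro rfl
    exact hC0 (by rw [← hd, zero_mul])
  have hd0 : d ≠ 0 := by
    rintro rfl
    exact hC0 (by rw [← hd, mul_zero])
  have h4 : f * d = vdm k q id * f' := by
    refine mul_left_cancel₀ hu0 ?_
    rw [← hf', ← hd] at h1
    linear_combination h1
  -- The reduced denominator `d` is prime to `f'`, hence divides the determinant. It also divides
  -- `C`, so it is homogeneous in the last variable, hence a monomial and a unit.
  obtain ⟨e, he⟩ := hrel.symm.dvd_of_dvd_mul_right (Dvd.intro_left f h4)
  have hdc : ∀ i, ConstAt d i := by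
    refine subsingleton_of_mul_eq_vdm hq hal Function.injective_id he.symm
      (b := Fin.last (r + 1)) (ConstAt.of_mul (e := u) (mul_ne_zero hd0 hu0) ?_)
    rw [mul_comm, hd]
    exact hCc
  obtain ⟨d', hd'⟩ := (isUnit_of_constAt k _ n hd0 hdc).exists_right_inv
  refine ⟨f' * d', ?_⟩
  rw [← mul_assoc, ← h4, mul_assoc, hd', mul_one]

end Divisibility

/-! ### Substituting one variable for another -/

section Substitution

variable {k : Type*} [Field k] {n : ℕ} {ι : Type*} [DecidableEq ι]

/-- The exponent obtained by the substitution of `x_l` for `x_o`. -/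
def foldHom (o l : ι) : (ι → Fin n → ℤ) →+ (ι → Fin n → ℤ) where
  toFun γ := Function.update γ o 0 + Pi.single l (γ o)
  map_zero' := by simp
  map_add' a b := by
    rw [Pi.add_apply, Pi.single_add, show Function.update (a + b) o 0 =
      Function.update a o 0 + Function.update b o 0 by rw [← Function.update_add, add_zero]]
    abel

theorem foldHom_apply (o l : ι) (γ : ι → Fin n → ℤ) :
    foldHom o l γ = Function.update γ o 0 + Pi.single l (γ o) := rfl

/-- Substituting a variable for itself lets one formula, `sum_coeffAt_mul_mono`, give both the
expansion of `f` and its substitutions. -/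
theorem foldHom_self (o : ι) (γ : ι → Fin n → ℤ) : foldHom o o γ = γ := by
  funext i
  rw [foldHom_apply, Pi.add_apply]
  by_cases h : i = o
  · subst h
    simp
  · simp [h]

/-- The substitution of `x_l` for `x_o`. -/
def substHom (k : Type*) [Field k] {n : ℕ} {ι : Type*} [DecidableEq ι] (o l : ι) :
    AddMonoidAlgebra k (ι → Fin n → ℤ) →ₐ[k] AddMonoidAlgebra k (ι → Fin n → ℤ) :=
  mapDomainAlgHom k k (foldHom o l)

theorem substHom_single (o l : ι) (γ : ι → Fin n → ℤ) (a : k) :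
    substHom k o l (single γ a) = single (foldHom o l γ) a :=
  mapDomain_single

theorem substHom_mono (o l : ι) (Q : Fin n → ℤ) : substHom k o l (mono k o Q) = mono k l Q := by
  have h : Function.update (Pi.single o Q : ι → Fin n → ℤ) o 0 = 0 := by
    funext i
    by_cases hi : i = o
    · subst hi
      simp
    · simp [hi]
  rw [mono, substHom_single, foldHom_apply, h, zero_add, Pi.single_eq_same]
  rfl

theorem substHom_mono_of_ne {o l i : ι} (h : i ≠ o) (Q : Fin n → ℤ) :
    substHom k o l (mono k i Q) = mono k i Q := by
  rw [mono, substHom_single, foldHom_apply]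
  congr 1
  rw [Pi.single_eq_of_ne h.symm, Pi.single_zero, add_zero, Function.update_eq_self_iff,
    Pi.single_eq_of_ne h.symm]

/-- The coefficients of `f` as a polynomial in `x_o` with exponents `q`. -/
def coeffAt (o : ι) {r : ℕ} (q : Fin r → Fin n → ℤ) (f : AddMonoidAlgebra k (ι → Fin n → ℤ))
    (j : Fin r) : AddMonoidAlgebra k (ι → Fin n → ℤ) :=
  ∑ γ ∈ f.coeff.support, if γ o = q j then single (Function.update γ o 0) (f.coeff γ) else 0

theorem sum_coeffAt_mul_mono {o : ι} {r : ℕ} {q : Fin r → Fin n → ℤ} (hq : Function.Injective q)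
    {f : AddMonoidAlgebra k (ι → Fin n → ℤ)} (hf : ∀ γ ∈ f.coeff.support, γ o ∈ Set.range q)
    (l : ι) : ∑ j, coeffAt o q f j * mono k l (q j) = substHom k o l f := by
  conv_rhs => rw [eq_sum_single f, map_sum]
  simp only [coeffAt, Finset.sum_mul]
  rw [Finset.sum_comm]
  refine Finset.sum_congr rfl fun γ hγ => ?_
  obtain ⟨j, hj⟩ := hf γ hγ
  rw [Finset.sum_eq_single j]
  · rw [if_pos hj.symm, mono, single_mul_single, mul_one, substHom_single, foldHom_apply, hj]
  · intro j' _ hj'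
    rw [if_neg, zero_mul]
    rw [← hj]
    exact (hq.ne hj').symm
  · simp

/-- A Laurent polynomial that vanishes when any of the variables is substituted for the last one is
a multiple of the generalised Vandermonde determinant. -/
theorem vdm_dvd_of_substHom {r : ℕ} {q : Fin (r + 2) → Fin n → ℤ} (hq : Function.Injective q)
    (hal : r = 0 ∨ ¬ Aligned q) {f : AddMonoidAlgebra k (Fin (r + 2) → Fin n → ℤ)}
    (hf : ∀ γ ∈ f.coeff.support, γ (Fin.last (r + 1)) ∈ Set.range q)
    (hf0 : ∀ i : Fin (r + 1), substHom k (Fin.last (r + 1)) i.castSucc f = 0) :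
    vdm k q id ∣ f := by
  have h := vdm_dvd hq hal (coeffAt (Fin.last (r + 1)) q f) fun i => by
    rw [sum_coeffAt_mul_mono hq hf, hf0]
  rw [sum_coeffAt_mul_mono hq hf] at h
  convert h
  conv_lhs => rw [eq_sum_single f]
  conv_rhs => rw [eq_sum_single f, map_sum]
  refine Finset.sum_congr rfl fun γ _ => ?_
  rw [substHom_single, foldHom_self]

/-- After the substitution two columns coincide. -/
theorem substHom_vdm {r : ℕ} (q : Fin (r + 1) → Fin n → ℤ) (i : Fin r) :
    substHom k (Fin.last r) i.castSucc (vdm k q id) = 0 := by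
  rw [vdm, AlgHom.map_det]
  refine Matrix.det_zero_of_column_eq (Fin.castSucc_ne_last i) fun j => ?_
  simp only [AlgHom.mapMatrix_apply, Matrix.map_apply, Matrix.of_apply, id]
  rw [substHom_mono, substHom_mono_of_ne (Fin.castSucc_ne_last i)]

end Substitution

/-! ### Supports of quotients -/

section Supports

variable {k : Type*} [Field k] {n : ℕ} {r : ℕ}

/-- Top degrees add, and the top degree of the determinant at `x_i` is at least `w (q j)`, since
some permutation places `q j` there. -/
theorem exists_le_of_mem_support {L : Type*} [AddCommGroup L] [LinearOrder L]
    [IsOrderedAddMonoid L] {q : Fin r → Fin n → ℤ} (hq : Function.Injective q)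
    {g : AddMonoidAlgebra k (Fin r → Fin n → ℤ)} {γ : Fin r → Fin n → ℤ}
    (hγ : γ ∈ g.coeff.support) (w : (Fin n → ℤ) →+ L) (i j : Fin r) :
    ∃ γ' ∈ (vdm k q id * g).coeff.support, w (q j) + w (γ i) ≤ w (γ' i) := by
  have hg : g ≠ 0 := by
    rintro rfl
    simp at hγ
  obtain ⟨a, ha⟩ := exists_isTop (coordHom i w) (vdm_ne_zero (k := k) hq Function.injective_id)
  obtain ⟨b, hb⟩ := exists_isTop (coordHom i w) hg
  obtain ⟨γ', hγ', h⟩ := (ha.mul hb).attained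
  refine ⟨γ', hγ', ?_⟩
  rw [coordHom_apply] at h
  rw [h]
  refine add_le_add ?_ (hb.le γ hγ)
  have := ha.le _ (expo_mem_support hq Function.injective_id (Equiv.swap i j))
  rw [coordHom_apply, show i = id i from rfl, expo_apply q Function.injective_id] at this
  simpa using this

/-- Taking `q j` maximal for `w` gives `w (γ i) ≤ 0`; the coordinate functionals and their negatives
then force zero. -/
theorem apply_eq_zero_of_mem_support {q : Fin r → Fin n → ℤ} (hq : Function.Injective q)
    {g : AddMonoidAlgebra k (Fin r → Fin n → ℤ)} {i : Fin r}
    (hf : ∀ γ ∈ (vdm k q id * g).coeff.support, γ i ∈ Set.range q)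
    {γ : Fin r → Fin n → ℤ} (hγ : γ ∈ g.coeff.support) : γ i = 0 := by
  have key : ∀ w : (Fin n → ℤ) →+ ℤ, w (γ i) ≤ 0 := by
    intro w
    have : Nonempty (Fin r) := ⟨i⟩
    obtain ⟨j, hj⟩ := Finite.exists_max fun a => w (q a)
    obtain ⟨γ', hγ', h⟩ := exists_le_of_mem_support hq hγ w i j
    obtain ⟨j', hj'⟩ := hf γ' hγ'
    rw [← hj'] at h
    have := hj j'
    omega
  funext x
  have h1 := key (Pi.evalAddMonoidHom (fun _ : Fin n => ℤ) x)
  have h2 := key (-Pi.evalAddMonoidHom (fun _ : Fin n => ℤ) x)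
  rw [AddMonoidHom.neg_apply] at h2
  simp only [Pi.evalAddMonoidHom_apply] at h1 h2
  rw [Pi.zero_apply]
  omega

/-- The embedding of the lattice in the real vector space. -/
def realHom (n : ℕ) : (Fin n → ℤ) →+ (Fin n → ℝ) where
  toFun P i := P i
  map_zero' := by ext; simp
  map_add' a b := by ext; simp

/-- The hull of the finite set `F` is closed, so a point outside it would be strictly separated by a
functional. Working with `F` avoids any closedness assumption on `Δ`. -/
theorem mem_latticePoints_of_forall_exists_le {Δ : Set (Fin n → ℝ)} (hΔ : Convex ℝ Δ)
    (F : Finset (Fin n → ℤ)) (hF : ∀ P ∈ F, P ∈ latticePoints Δ) (P : Fin n → ℤ)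
    (h : ∀ w : (Fin n → ℤ) →+ ℝ, ∃ P' ∈ F, w P ≤ w P') : P ∈ latticePoints Δ := by
  have hsub : convexHull ℝ (realHom n '' (F : Set (Fin n → ℤ))) ⊆ Δ := by
    refine convexHull_min ?_ hΔ
    rintro _ ⟨P', hP', rfl⟩
    exact hF P' hP'
  refine hsub ?_
  by_contra hP
  obtain ⟨w, u, hu, hu'⟩ := geometric_hahn_banach_closed_point (convex_convexHull ℝ _)
    ((F.finite_toSet.image (realHom n)).isClosed_convexHull ℝ) hP
  obtain ⟨P', hP', hle⟩ := h ((w : (Fin n → ℝ) →+ ℝ).comp (realHom n))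
  have h1 := hu _ (subset_convexHull ℝ _ ⟨P', hP', rfl⟩)
  exact absurd (h1.trans hu') (not_lt.2 hle)

theorem apply_mem_shiftSet_of_mem_support {q : Fin r → Fin n → ℤ} (hq : Function.Injective q)
    {Δ : Set (Fin n → ℝ)} (hΔ : Convex ℝ Δ) {g : AddMonoidAlgebra k (Fin r → Fin n → ℤ)}
    {i : Fin r} (hf : ∀ γ ∈ (vdm k q id * g).coeff.support, γ i ∈ latticePoints Δ)
    {γ : Fin r → Fin n → ℤ} (hγ : γ ∈ g.coeff.support) :
    γ i ∈ shiftSet (latticePoints Δ) (Set.range q) := by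
  classical
  rintro _ ⟨j, rfl⟩
  refine mem_latticePoints_of_forall_exists_le hΔ
    ((vdm k q id * g).coeff.support.image fun γ' => γ' i) ?_ _ fun w => ?_
  · intro P hP
    obtain ⟨γ', hγ', rfl⟩ := Finset.mem_image.1 hP
    exact hf γ' hγ'
  · obtain ⟨γ', hγ', h⟩ := exists_le_of_mem_support hq hγ w i j
    refine ⟨γ' i, Finset.mem_image_of_mem _ hγ', ?_⟩
    rwa [map_add, add_comm]

end Supports

/-! ### Tensors and exterior powers as Laurent polynomials -/

section Embeddings

variable (k : Type*) [Field k] {n : ℕ} {ι : Type*} [Fintype ι] [DecidableEq ι] {r : ℕ}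
  (c : Fin r → ι) (l : ι) (S U : Set (Fin n → ℤ))

/-- The point `Q` as the monomial `x_l ^ Q`. -/
def pointHom : PointSpace k U →ₗ[k] AddMonoidAlgebra k (ι → Fin n → ℤ) :=
  Finsupp.linearCombination k fun Q : U => mono k l Q.1

variable {S U} in
theorem pointHom_pt (Q : U) : pointHom k l U (pt k Q) = mono k l Q.1 := by
  simp [pointHom]

/-- The map `P_1 ⊗ ⋯ ⊗ P_r ⊗ Q ↦ x_{c 1} ^ P_1 ⋯ x_{c r} ^ P_r * x_l ^ Q`. -/
def tensorHom : (⨂[k]^r (PointSpace k S)) ⊗[k] PointSpace k U →ₗ[k]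
    AddMonoidAlgebra k (ι → Fin n → ℤ) :=
  TensorProduct.lift ((LinearMap.mul k (AddMonoidAlgebra k (ι → Fin n → ℤ))).compl₁₂
    (PiTensorProduct.lift ((MultilinearMap.mkPiAlgebra k (Fin r)
      (AddMonoidAlgebra k (ι → Fin n → ℤ))).compLinearMap fun i => pointHom k (c i) S))
    (pointHom k l U))

variable {S U} in
theorem tensorHom_pt (P : Fin r → S) (Q : U) :
    tensorHom k c l S U (PiTensorProduct.tprod k (fun i => pt k (P i)) ⊗ₜ[k] pt k Q) =
      (∏ i, mono k (c i) (P i).1) * mono k l Q.1 := by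
  rw [tensorHom, TensorProduct.lift.tmul, LinearMap.compl₁₂_apply, PiTensorProduct.lift.tprod,
    MultilinearMap.compLinearMap_apply, MultilinearMap.mkPiAlgebra_apply, LinearMap.mul_apply',
    pointHom_pt]
  simp only [pointHom_pt]

/-- The alternating map `P_1, …, P_r ↦ det (x_{c j} ^ P_i)`. -/
def detMap : PointSpace k S [⋀^Fin r]→ₗ[k] AddMonoidAlgebra k (ι → Fin n → ℤ) :=
  AlternatingMap.compLinearMap
    { toMultilinearMap := (Matrix.detRowAlternating (n := Fin r)
        (R := AddMonoidAlgebra k (ι → Fin n → ℤ))).toMultilinearMap.restrictScalars k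
      map_eq_zero_of_eq' := fun v _ _ h hij => Matrix.detRowAlternating.map_eq_zero_of_eq v h hij }
    (LinearMap.pi fun i => pointHom k (c i) S)

variable {S} in
theorem detMap_pt (P : Fin r → S) :
    detMap k c S (fun i => pt k (P i)) = vdm k (fun i => (P i).1) c := by
  change Matrix.det _ = Matrix.det _
  exact congrArg Matrix.det (Matrix.ext fun i j => pointHom_pt k (c j) (P i))

/-- The map `P_1 ∧ ⋯ ∧ P_r ⊗ Q ↦ det (x_{c j} ^ P_i) * x_l ^ Q`. -/
def wedgeHom : (⋀[k]^r (PointSpace k S)) ⊗[k] PointSpace k U →ₗ[k]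
    AddMonoidAlgebra k (ι → Fin n → ℤ) :=
  TensorProduct.lift ((LinearMap.mul k (AddMonoidAlgebra k (ι → Fin n → ℤ))).compl₁₂
    (exteriorPower.alternatingMapLinearEquiv (detMap k c S)) (pointHom k l U))

variable {S U} in
theorem wedgeHom_pt (P : Fin r → S) (Q : U) :
    wedgeHom k c l S U (exteriorPower.ιMulti k r (fun i => pt k (P i)) ⊗ₜ[k] pt k Q) =
      vdm k (fun i => (P i).1) c * mono k l Q.1 := by
  rw [wedgeHom, TensorProduct.lift.tmul, LinearMap.compl₁₂_apply, LinearMap.mul_apply',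
    exteriorPower.alternatingMapLinearEquiv_apply_ιMulti, detMap_pt, pointHom_pt]

/-- The basis of `S^{⊗r} ⊗ U` given by the tensors of points. -/
def tensorBasis : Module.Basis ((Fin r → S) × U) k
    ((⨂[k]^r (PointSpace k S)) ⊗[k] PointSpace k U) :=
  (Basis.piTensorProduct fun _ : Fin r => Finsupp.basisSingleOne).tensorProduct
    Finsupp.basisSingleOne

variable {S U} in
theorem tensorBasis_apply (P : Fin r → S) (Q : U) :
    tensorBasis k S U (P, Q) = PiTensorProduct.tprod k (fun i => pt k (P i)) ⊗ₜ[k] pt k Q := by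
  rw [tensorBasis, Module.Basis.tensorProduct_apply, Basis.piTensorProduct_apply]
  simp only [Finsupp.coe_basisSingleOne]

/-- A linear order on the points. -/
@[reducible]
def pointOrder (S : Set (Fin n → ℤ)) : LinearOrder S :=
  LinearOrder.lift' (fun P : S => toLex P.1) fun _ _ h => Subtype.ext (toLex.injective h)

/-- The basis of `⋀ʳ S ⊗ U` given by the exterior products of increasing sequences of points. -/
def wedgeBasis : letI := pointOrder S
    Module.Basis (Set.powersetCard S r × U) k
      ((⋀[k]^r (PointSpace k S)) ⊗[k] PointSpace k U) :=
  letI := pointOrder S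
  (Module.Basis.exteriorPower r Finsupp.basisSingleOne).tensorProduct Finsupp.basisSingleOne

/-- The increasing enumeration of a set of points. -/
def enum {S : Set (Fin n → ℤ)} (s : Set.powersetCard S r) : Fin r → S :=
  letI := pointOrder S
  Set.powersetCard.ofFinEmbEquiv.symm s

theorem enum_injective {S : Set (Fin n → ℤ)} (s : Set.powersetCard S r) :
    Function.Injective (enum s) :=
  letI := pointOrder S
  (Set.powersetCard.ofFinEmbEquiv.symm s).injective

theorem mem_range_enum {S : Set (Fin n → ℤ)} (s : Set.powersetCard S r) (P : S) :
    P ∈ Set.range (enum s) ↔ P ∈ s.1 :=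
  letI := pointOrder S
  Set.powersetCard.mem_range_ofFinEmbEquiv_symm_iff_mem s P

variable {S U} in
theorem wedgeBasis_apply (s : Set.powersetCard S r) (Q : U) :
    wedgeBasis k S U (s, Q) =
      exteriorPower.ιMulti k r (fun i => pt k (enum s i)) ⊗ₜ[k] pt k Q := by
  rw [wedgeBasis, Module.Basis.tensorProduct_apply, exteriorPower.basis_apply]
  rfl

variable {k}

/-- The coefficient at the exponent `γ` as a linear functional. -/
def coeffHom (γ : ι → Fin n → ℤ) : AddMonoidAlgebra k (ι → Fin n → ℤ) →ₗ[k] k :=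
  Finsupp.lapply γ ∘ₗ (coeffLinearEquiv k).toLinearMap

theorem coeffHom_apply (γ : ι → Fin n → ℤ) (f : AddMonoidAlgebra k (ι → Fin n → ℤ)) :
    coeffHom γ f = f.coeff γ := rfl

theorem prod_mono_mul_mono (P : Fin r → Fin n → ℤ) (Q : Fin n → ℤ) :
    (∏ i, mono k (c i) (P i)) * mono k l Q =
      single (expo P c id + Pi.single l Q) (1 : k) := by
  rw [prod_mono, mono, single_mul_single, one_mul]
  rfl

theorem vdm_mul_mono (P : Fin r → Fin n → ℤ) (Q : Fin n → ℤ) :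
    vdm k P c * mono k l Q = ∑ σ : Equiv.Perm (Fin r),
      Equiv.Perm.sign σ • single (expo P c σ + Pi.single l Q : ι → Fin n → ℤ) (1 : k) := by
  rw [vdm_eq_sum, Finset.sum_mul]
  refine Finset.sum_congr rfl fun σ _ => ?_
  rw [smul_mul_assoc, mono, single_mul_single, one_mul]

variable {c l}

theorem expo_add_single_apply (hc : Function.Injective c) (hl : l ∉ Set.range c)
    (P : Fin r → Fin n → ℤ) (σ : Fin r → Fin r) (Q : Fin n → ℤ) (i : Fin r) :
    (expo P c σ + Pi.single l Q : ι → Fin n → ℤ) (c i) = P (σ i) := by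
  rw [Pi.add_apply, expo_apply P hc, Pi.single_eq_of_ne, add_zero]
  rintro rfl
  exact hl ⟨i, rfl⟩

theorem expo_add_single_apply_self (hl : l ∉ Set.range c)
    (P : Fin r → Fin n → ℤ) (σ : Fin r → Fin r) (Q : Fin n → ℤ) :
    (expo P c σ + Pi.single l Q : ι → Fin n → ℤ) l = Q := by
  rw [Pi.add_apply, expo_apply_of_notMem P hl, Pi.single_eq_same, zero_add]

variable {S U}

/-- Distinct basis tensors go to distinct monomials. -/
theorem tensorHom_injective (hc : Function.Injective c) (hl : l ∉ Set.range c) :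
    Function.Injective (tensorHom k c l S U) := by
  refine LinearMap.injective_of_linearIndependent (tensorBasis k S U).span_eq ?_
  refine LinearIndependent.of_pairwise_dual_eq_zero_one _
    (fun z => coeffHom (expo (fun i => (z.1 i).1) c id + Pi.single l z.2.1)) ?_ ?_
  · rintro ⟨P, Q⟩ ⟨P', Q'⟩ hne
    rw [Function.comp_apply, tensorBasis_apply, tensorHom_pt, prod_mono_mul_mono, coeffHom_apply,
      coeff_single, Finsupp.single_eq_of_ne]
    intro h
    refine hne (Prod.ext (funext fun i => Subtype.ext ?_) (Subtype.ext ?_))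
    · have := congrFun h (c i)
      rwa [expo_add_single_apply hc hl, expo_add_single_apply hc hl] at this
    · have := congrFun h l
      rwa [expo_add_single_apply_self hl, expo_add_single_apply_self hl] at this
  · rintro ⟨P, Q⟩
    rw [Function.comp_apply, tensorBasis_apply, tensorHom_pt, prod_mono_mul_mono, coeffHom_apply,
      coeff_single, Finsupp.single_eq_same]

/-- The exponents in the image of a basis vector determine its set of points and `Q`, so the images
have disjoint supports. The identity permutation contributes coefficient `1`, in every
characteristic. -/
theorem wedgeHom_injective (hc : Function.Injective c) (hl : l ∉ Set.range c) :
    Function.Injective (wedgeHom k c l S U) := by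
  refine LinearMap.injective_of_linearIndependent (wedgeBasis k S U).span_eq ?_
  refine LinearIndependent.of_pairwise_dual_eq_zero_one _
    (fun z => coeffHom (expo (fun i => (enum z.1 i).1) c id + Pi.single l z.2.1)) ?_ ?_
  · rintro ⟨s, Q⟩ ⟨s', Q'⟩ hne
    rw [Function.comp_apply, wedgeBasis_apply, wedgeHom_pt, vdm_mul_mono, map_sum]
    refine Finset.sum_eq_zero fun σ _ => ?_
    rw [coeffHom_apply, coeff_smul, coeff_single, Finsupp.smul_apply, Finsupp.single_eq_of_ne,
      smul_zero]
    intro h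
    refine hne (Prod.ext (Subtype.ext ?_) (Subtype.ext ?_))
    · have h1 : ∀ i, enum s i = enum s' (σ i) := fun i => Subtype.ext <| by
        have := congrFun h (c i)
        rwa [expo_add_single_apply hc hl, expo_add_single_apply hc hl] at this
      ext P
      rw [← mem_range_enum, ← mem_range_enum]
      constructor
      · rintro ⟨i, rfl⟩
        exact ⟨σ i, (h1 i).symm⟩
      · rintro ⟨i, rfl⟩
        exact ⟨σ.symm i, by rw [h1, Equiv.apply_symm_apply]⟩
    · have := congrFun h l
      rwa [expo_add_single_apply_self hl, expo_add_single_apply_self hl] at this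
  · rintro ⟨s, Q⟩
    rw [Function.comp_apply, wedgeBasis_apply, wedgeHom_pt, vdm_mul_mono, map_sum,
      Finset.sum_eq_single 1]
    · simp [coeffHom_apply]
    · intro σ _ hσ
      rw [coeffHom_apply, coeff_smul, coeff_single, Finsupp.smul_apply, Finsupp.single_eq_of_ne,
        smul_zero]
      intro h
      refine hσ (Equiv.ext fun i => (enum_injective s (Subtype.ext ?_)).symm)
      have := congrFun h (c i)
      rwa [expo_add_single_apply hc hl, expo_add_single_apply hc hl] at this
    · simp

/-- The Laurent polynomials with exponents in `W`. -/
def suppIn (k : Type*) [Field k] {Γ : Type*} (W : Set Γ) :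
    Submodule k (AddMonoidAlgebra k Γ) where
  carrier := {f | ∀ γ ∈ f.coeff.support, γ ∈ W}
  zero_mem' := by simp
  add_mem' := by
    classical
    intro f g hf hg γ hγ
    rcases Finset.mem_union.1 (Finsupp.support_add hγ) with h | h
    · exact hf γ h
    · exact hg γ h
  smul_mem' := fun a f hf γ hγ => hf γ (Finsupp.support_smul hγ)

theorem single_mem_suppIn {Γ : Type*} {W : Set Γ} {γ : Γ} (h : γ ∈ W) (a : k) :
    single γ a ∈ suppIn k W := by
  intro δ hδ
  rw [coeff_single] at hδ
  rw [Finset.mem_singleton.1 (Finsupp.support_single_subset hδ)]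
  exact h

/-- The exponents whose components at `c i` lie in `S` and whose component at `l` lies in `U`. -/
def box (c : Fin r → ι) (l : ι) (S U : Set (Fin n → ℤ)) : Set (ι → Fin n → ℤ) :=
  {γ | (∀ i, γ (c i) ∈ S) ∧ γ l ∈ U}

theorem mem_of_basis_mem {M N α : Type*} [AddCommGroup M] [Module k M] [AddCommGroup N]
    [Module k N] (b : Module.Basis α k M) (f : M →ₗ[k] N) {W : Submodule k N}
    (h : ∀ a, f (b a) ∈ W) (t : M) : f t ∈ W := by
  have : (⊤ : Submodule k M) ≤ W.comap f := by
    rw [← b.span_eq, Submodule.span_le]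
    rintro _ ⟨a, rfl⟩
    exact h a
  exact this trivial

theorem tensorHom_mem_suppIn (hc : Function.Injective c) (hl : l ∉ Set.range c)
    (t : (⨂[k]^r (PointSpace k S)) ⊗[k] PointSpace k U) :
    tensorHom k c l S U t ∈ suppIn k (box c l S U) := by
  refine mem_of_basis_mem (tensorBasis k S U) _ ?_ t
  rintro ⟨P, Q⟩
  rw [tensorBasis_apply, tensorHom_pt, prod_mono_mul_mono]
  refine single_mem_suppIn (W := box c l S U) ⟨fun i => ?_, ?_⟩ _
  · rw [expo_add_single_apply hc hl]
    exact (P i).2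
  · rw [expo_add_single_apply_self hl]
    exact Q.2

theorem wedgeHom_mem_suppIn (hc : Function.Injective c) (hl : l ∉ Set.range c)
    (t : (⋀[k]^r (PointSpace k S)) ⊗[k] PointSpace k U) :
    wedgeHom k c l S U t ∈ suppIn k (box c l S U) := by
  refine mem_of_basis_mem (wedgeBasis k S U) _ ?_ t
  rintro ⟨s, Q⟩
  rw [wedgeBasis_apply, wedgeHom_pt, vdm_mul_mono]
  refine Submodule.sum_mem _ fun σ _ => ?_
  rw [Units.smul_def, ← Int.cast_smul_eq_zsmul k]
  refine Submodule.smul_mem _ _ (single_mem_suppIn (W := box c l S U) ⟨fun i => ?_, ?_⟩ _)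
  · rw [expo_add_single_apply hc hl]
    exact (enum s (σ i)).2
  · rw [expo_add_single_apply_self hl]
    exact Q.2

end Embeddings

/-! ### The maps `δ` as substitutions -/

section Delta

variable {k : Type*} [Field k] {n p : ℕ} {S T : Set (Fin n → ℤ)}

theorem mono_add {ι : Type*} [DecidableEq ι] (i : ι) (P Q : Fin n → ℤ) :
    mono k i (P + Q) = mono k i P * mono k i Q := by
  rw [mono, mono, mono, single_mul_single, ← Pi.single_add, one_mul]

theorem tensorHom_tensorDelta (i : Fin (p + 1))
    (t : (⨂[k]^(p + 1) (PointSpace k S)) ⊗[k] PointSpace k T) :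
    tensorHom k (fun j => (i.succAbove j).castSucc) i.castSucc S (S + T)
        (tensorDelta k S T p i t) =
      substHom k (Fin.last (p + 1)) i.castSucc
        (tensorHom k Fin.castSucc (Fin.last (p + 1)) S T t) := by
  suffices h : tensorHom k (fun j => (i.succAbove j).castSucc) i.castSucc S (S + T) ∘ₗ
      tensorDelta k S T p i = (substHom k (Fin.last (p + 1)) i.castSucc).toLinearMap ∘ₗ
        tensorHom k Fin.castSucc (Fin.last (p + 1)) S T from LinearMap.congr_fun h t
  refine (tensorBasis k S T).ext ?_
  rintro ⟨P, Q⟩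
  rw [tensorBasis_apply, LinearMap.comp_apply, LinearMap.comp_apply, tensorDelta_apply,
    tensorHom_pt, tensorHom_pt, AlgHom.toLinearMap_apply, map_mul, map_prod, substHom_mono,
    Fin.prod_univ_succAbove _ i, mono_add]
  simp only [substHom_mono_of_ne (k := k) (Fin.castSucc_ne_last _)]
  ring

theorem substHom_vdm_castSucc (i : Fin (p + 1)) (P : Fin (p + 1) → Fin n → ℤ) :
    substHom k (Fin.last (p + 1)) i.castSucc (vdm k P Fin.castSucc) = vdm k P Fin.castSucc := by
  rw [vdm, AlgHom.map_det]
  exact congrArg Matrix.det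
    (Matrix.ext fun _ _ => substHom_mono_of_ne (Fin.castSucc_ne_last _) _)

/-- This is the Laplace expansion along the column of `x_i`. The single map `δ` thus encodes each of
the substitutions, up to sign. -/
theorem wedgeHom_wedgeDelta (i : Fin (p + 1))
    (t : (⋀[k]^(p + 1) (PointSpace k S)) ⊗[k] PointSpace k T) :
    wedgeHom k (fun j => (i.succAbove j).castSucc) i.castSucc S (S + T) (wedgeDelta k S T p t) =
      (-1 : ℤ) ^ ((i : ℕ) + 1) • substHom k (Fin.last (p + 1)) i.castSucc
        (wedgeHom k Fin.castSucc (Fin.last (p + 1)) S T t) := by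
  suffices h : wedgeHom k (fun j => (i.succAbove j).castSucc) i.castSucc S (S + T) ∘ₗ
      wedgeDelta k S T p = (-1 : ℤ) ^ ((i : ℕ) + 1) •
        (substHom k (Fin.last (p + 1)) i.castSucc).toLinearMap ∘ₗ
        wedgeHom k Fin.castSucc (Fin.last (p + 1)) S T from LinearMap.congr_fun h t
  refine (wedgeBasis k S T).ext ?_
  rintro ⟨s, Q⟩
  rw [wedgeBasis_apply, LinearMap.comp_apply, LinearMap.smul_apply, LinearMap.comp_apply,
    wedgeDelta_apply, wedgeHom_pt, AlgHom.toLinearMap_apply, map_mul, map_sum, substHom_mono,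
    substHom_vdm_castSucc, vdm_succ _ _ i, Finset.sum_mul, Finset.smul_sum]
  refine Finset.sum_congr rfl fun a _ => ?_
  rw [map_zsmul, wedgeHom_pt, mono_add]
  simp only [zsmul_eq_mul]
  push_cast
  -- The sign `(-1)^(a+i)` of the expansion times `(-1)^(i+1)` is the sign `(-1)^(a+1)` of `δ`.
  have h : ((-1 : AddMonoidAlgebra k (Fin (p + 2) → Fin n → ℤ)) ^ (i : ℕ)) * (-1) ^ (i : ℕ) = 1 := by
    rw [← mul_pow]
    simp
  linear_combination ((-1) ^ (a : ℕ) * (mono k i.castSucc (enum s a).1 * mono k i.castSucc Q.1) *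
    vdm k (fun b => (enum s (a.succAbove b)).1) (fun b => (i.succAbove b).castSucc)) * h

end Delta

/-! ### Lattice polytopes of dimension greater than one -/

theorem vectorSpan_convexHull {V : Type*} [AddCommGroup V] [Module ℝ V] (s : Set V) :
    vectorSpan ℝ (convexHull ℝ s) = vectorSpan ℝ s := by
  rw [← direction_affineSpan, affineSpan_convexHull, direction_affineSpan]

/-- The points generating a lattice polytope are themselves lattice points of it; if these were
collinear, the direction space would be spanned by one vector. -/
theorem not_aligned_of_affineDim {n r : ℕ} {Δ : Set (Fin n → ℝ)} (hΔ : IsLatticePolytope Δ)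
    (hdim : 1 < affineDim Δ) (Q : Fin r ≃ latticePoints Δ) : ¬ Aligned fun j => (Q j).1 := by
  intro hal
  obtain ⟨V, hV⟩ := hΔ
  have hV' : Δ = convexHull ℝ (realHom n '' (V : Set (Fin n → ℤ))) := hV
  have hVT : ∀ v ∈ V, v ∈ latticePoints Δ := by
    intro v hv
    change realHom n v ∈ Δ
    rw [hV']
    exact subset_convexHull ℝ _ ⟨v, hv, rfl⟩
  have hpar : ∀ a ∈ V, ∀ b ∈ V, ∀ c ∈ V, Par (b - a) (c - a) := by
    intro a ha b hb c hc
    simpa using hal (Q.symm ⟨a, hVT a ha⟩) (Q.symm ⟨b, hVT b hb⟩) (Q.symm ⟨c, hVT c hc⟩)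
  suffices h : ∃ d : Fin n → ℝ, vectorSpan ℝ Δ ≤ Submodule.span ℝ {d} by
    obtain ⟨d, hd⟩ := h
    have h1 := Submodule.finrank_mono hd
    have h2 := finrank_span_le_card (R := ℝ) ({d} : Set (Fin n → ℝ))
    rw [Set.toFinset_singleton, Finset.card_singleton] at h2
    exact absurd hdim (not_lt.2 (h1.trans h2))
  rw [hV', vectorSpan_convexHull]
  rcases V.eq_empty_or_nonempty with rfl | ⟨a, ha⟩
  · exact ⟨0, by simp⟩
  rw [vectorSpan_eq_span_vsub_set_right ℝ (Set.mem_image_of_mem (realHom n) ha)]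
  by_cases hall : ∀ b ∈ V, b = a
  · refine ⟨0, Submodule.span_le.2 ?_⟩
    rintro _ ⟨_, ⟨b, hb, rfl⟩, rfl⟩
    simp [hall b hb]
  · push Not at hall
    obtain ⟨b, hb, hba⟩ := hall
    obtain ⟨z, hz⟩ := Function.ne_iff.1 hba
    have hz' : ((b z : ℝ) - a z) ≠ 0 := sub_ne_zero.2 (by exact_mod_cast hz)
    refine ⟨realHom n b - realHom n a, Submodule.span_le.2 ?_⟩
    rintro _ ⟨_, ⟨c, hc, rfl⟩, rfl⟩
    refine Submodule.mem_span_singleton.2 ⟨((c z : ℝ) - a z) / (b z - a z), ?_⟩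
    funext x
    have h := hpar a ha b hb c hc x z
    simp only [Pi.sub_apply] at h
    have h' : ((b x : ℝ) - a x) * (c z - a z) = (b z - a z) * (c x - a x) := by exact_mod_cast h
    change ((c z : ℝ) - a z) / (b z - a z) * (b x - a x) = c x - a x
    field_simp
    linarith

/-! ### Bases of the kernels -/

/-- Multiplication by `D` and `Φ` are both injective, so independence and spanning can be checked on
the quotients by `D`. Both kernels are treated this way. -/
theorem exists_basis {k M A α : Type*} [Field k] [AddCommGroup M] [Module k M] [CommRing A]
    [NoZeroDivisors A] [Algebra k A] {Φ : M →ₗ[k] A} (hΦ : Function.Injective Φ)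
    {N : Submodule k M} {v : α → M} (hv : ∀ i, v i ∈ N) {D : A} (hD : D ≠ 0) {e : α → A}
    (he : LinearIndependent k e) (hΦv : ∀ i, Φ (v i) = D * e i)
    (hN : ∀ t ∈ N, ∃ g ∈ Submodule.span k (Set.range e), Φ t = D * g) :
    ∃ b : Module.Basis α k N, ∀ i, (b i : M) = v i := by
  have hDe : LinearIndependent k (LinearMap.mulLeft k D ∘ e) :=
    he.map' _ (LinearMap.ker_eq_bot.2 (mul_right_injective₀ hD))
  have hcomp : Φ ∘ v = LinearMap.mulLeft k D ∘ e := funext hΦv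
  have hli : LinearIndependent k v := LinearIndependent.of_comp Φ (by rw [hcomp]; exact hDe)
  have hspan : N = Submodule.span k (Set.range v) := by
    refine le_antisymm (fun t ht => ?_) (Submodule.span_le.2 (Set.range_subset_iff.2 hv))
    obtain ⟨g, hg, hgt⟩ := hN t ht
    have h1 : Φ t ∈ (Submodule.span k (Set.range v)).map Φ := by
      rw [Submodule.map_span, ← Set.range_comp, hcomp, Set.range_comp, ← Submodule.map_span]
      exact ⟨g, hg, hgt.symm⟩
    obtain ⟨s, hs, hst⟩ := h1
    rwa [← hΦ hst]
  subst hspan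
  exact ⟨Module.Basis.span hli, fun i => by rw [Module.Basis.span_apply]⟩

section Tensor

variable {k : Type*} [Field k] {n r : ℕ}

/-- The exponent of `x_1 ^ P_1 ⋯ x_r ^ P_r`. -/
def tupleExpo {X : Set (Fin n → ℤ)} (P : Fin r → X) : Fin (r + 1) → Fin n → ℤ :=
  expo (fun i => (P i).1) Fin.castSucc id

theorem last_notMem_range_castSucc (r : ℕ) :
    Fin.last r ∉ Set.range (Fin.castSucc : Fin r → Fin (r + 1)) := by
  rintro ⟨i, hi⟩
  exact Fin.castSucc_ne_last i hi

theorem tupleExpo_castSucc {X : Set (Fin n → ℤ)} (P : Fin r → X) (i : Fin r) :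
    tupleExpo P i.castSucc = (P i).1 :=
  expo_apply _ (Fin.castSucc_injective r) _ _

theorem tupleExpo_last {X : Set (Fin n → ℤ)} (P : Fin r → X) :
    tupleExpo P (Fin.last r) = 0 :=
  expo_apply_of_notMem _ (last_notMem_range_castSucc r) _

theorem tupleExpo_injective (X : Set (Fin n → ℤ)) :
    Function.Injective (tupleExpo : (Fin r → X) → Fin (r + 1) → Fin n → ℤ) := by
  intro P P' h
  funext i
  refine Subtype.ext ?_
  rw [← tupleExpo_castSucc, h, tupleExpo_castSucc]

theorem exists_tupleExpo_eq {X : Set (Fin n → ℤ)} {γ : Fin (r + 1) → Fin n → ℤ}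
    (h : γ ∈ box Fin.castSucc (Fin.last r) X {0}) : ∃ P : Fin r → X, tupleExpo P = γ := by
  refine ⟨fun i => ⟨γ i.castSucc, h.1 i⟩, ?_⟩
  funext i
  induction i using Fin.lastCases with
  | last => rw [tupleExpo_last]; exact h.2.symm
  | cast i => rw [tupleExpo_castSucc]

/-- The elements of the form considered in the kernels are multiples of the generalised Vandermonde
determinant by Laurent polynomials with exponents in `X`. -/
theorem exists_eq_vdm_mul {Δ : Set (Fin n → ℝ)} (hΔ : Convex ℝ Δ)
    {q : Fin (r + 2) → Fin n → ℤ} (hq : Function.Injective q) (hal : ¬ Aligned q)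
    {f : AddMonoidAlgebra k (Fin (r + 2) → Fin n → ℤ)}
    (hf : f ∈ suppIn k (box Fin.castSucc (Fin.last (r + 1)) (latticePoints Δ) (Set.range q)))
    (hf0 : ∀ i : Fin (r + 1), substHom k (Fin.last (r + 1)) i.castSucc f = 0) :
    ∃ g ∈ suppIn k (box Fin.castSucc (Fin.last (r + 1))
      (shiftSet (latticePoints Δ) (Set.range q)) {0}), f = vdm k q id * g := by
  obtain ⟨g, rfl⟩ := vdm_dvd_of_substHom hq (Or.inr hal) (fun γ hγ => (hf γ hγ).2) hf0
  exact ⟨g, fun γ hγ => ⟨fun i => apply_mem_shiftSet_of_mem_support hq hΔ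
    (fun γ' hγ' => (hf γ' hγ').1 i) hγ,
    apply_eq_zero_of_mem_support hq (fun γ' hγ' => (hf γ' hγ').2) hγ⟩, rfl⟩

variable {S T : Set (Fin n → ℤ)}

/-- The shift by `P` splits off as a factor independent of `σ`; the signed sum over `σ` of the
remaining factors is the determinant. -/
theorem prod_mono_shiftPoint (Q : Fin (r + 1) ≃ T) (P : Fin r → shiftSet S T)
    (σ : Equiv.Perm (Fin (r + 1))) :
    (∏ i : Fin r, mono k i.castSucc (shiftPoint (P i) (Q (σ i.castSucc))).1) *
      mono k (Fin.last r) (Q (σ (Fin.last r))).1 =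
      single (tupleExpo P) 1 * ∏ i, mono k i (Q (σ i)).1 := by
  have h : ∀ i : Fin r, mono k i.castSucc (shiftPoint (P i) (Q (σ i.castSucc))).1 =
      mono k i.castSucc (P i).1 * mono k i.castSucc (Q (σ i.castSucc)).1 := fun i => mono_add _ _ _
  rw [Fin.prod_univ_castSucc, Finset.prod_congr rfl fun i _ => h i, Finset.prod_mul_distrib,
    prod_mono Finset.univ Fin.castSucc fun i => (P i).1, mul_assoc]
  rfl

theorem vdm_eq_sum_prod (q : Fin r → Fin n → ℤ) :
    vdm k q id = ∑ σ : Equiv.Perm (Fin r), Equiv.Perm.sign σ • ∏ i, mono k i (q (σ i)) :=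
  Matrix.det_apply _

theorem tensorHom_xTensor (Q : Fin (r + 1) ≃ T) (P : Fin r → shiftSet S T) :
    tensorHom k Fin.castSucc (Fin.last r) S T (xTensor k Q P) =
      vdm k (fun j => (Q j).1) id * single (tupleExpo P) 1 := by
  rw [xTensor, map_sum, vdm_eq_sum_prod, Finset.sum_mul]
  refine Finset.sum_congr rfl fun σ _ => ?_
  rw [Units.smul_def, Units.smul_def, map_zsmul, tensorHom_pt, prod_mono_shiftPoint,
    smul_mul_assoc, mul_comm]

theorem linearIndependent_single_tupleExpo (X : Set (Fin n → ℤ)) :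
    LinearIndependent k fun P : Fin r → X => (single (tupleExpo P) 1 :
      AddMonoidAlgebra k (Fin (r + 1) → Fin n → ℤ)) := by
  refine LinearIndependent.of_pairwise_dual_eq_zero_one _ (fun P => coeffHom (tupleExpo P)) ?_ ?_
  · intro P P' hne
    rw [coeffHom_apply, coeff_single, Finsupp.single_eq_of_ne]
    exact (tupleExpo_injective X).ne hne
  · intro P
    rw [coeffHom_apply, coeff_single, Finsupp.single_eq_same]

theorem mem_span_single_tupleExpo {X : Set (Fin n → ℤ)}
    {g : AddMonoidAlgebra k (Fin (r + 1) → Fin n → ℤ)}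
    (hg : g ∈ suppIn k (box Fin.castSucc (Fin.last r) X {0})) :
    g ∈ Submodule.span k (Set.range fun P : Fin r → X => (single (tupleExpo P) 1 :
      AddMonoidAlgebra k (Fin (r + 1) → Fin n → ℤ))) := by
  rw [eq_sum_single g]
  refine Submodule.sum_mem _ fun γ hγ => ?_
  obtain ⟨P, rfl⟩ := exists_tupleExpo_eq (hg γ hγ)
  have h : single (tupleExpo P) (g.coeff (tupleExpo P)) =
      g.coeff (tupleExpo P) • (single (tupleExpo P) 1 :
        AddMonoidAlgebra k (Fin (r + 1) → Fin n → ℤ)) := by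
    rw [smul_single, smul_eq_mul, mul_one]
  rw [h]
  exact Submodule.smul_mem _ _ (Submodule.subset_span ⟨P, rfl⟩)

theorem succAbove_castSucc_injective (i : Fin (r + 1)) :
    Function.Injective fun j => (i.succAbove j).castSucc :=
  (Fin.castSucc_injective _).comp Fin.succAbove_right_injective

theorem castSucc_notMem_range (i : Fin (r + 1)) :
    i.castSucc ∉ Set.range fun j => (i.succAbove j).castSucc := by
  rintro ⟨j, hj⟩
  exact Fin.succAbove_ne i j (Fin.castSucc_injective _ hj)

theorem mem_tensorKer_iff (t : (⨂[k]^(r + 1) (PointSpace k S)) ⊗[k] PointSpace k T) :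
    t ∈ tensorKer k S T (r + 1) ↔ ∀ i : Fin (r + 1), substHom k (Fin.last (r + 1)) i.castSucc
      (tensorHom k Fin.castSucc (Fin.last (r + 1)) S T t) = 0 := by
  rw [tensorKer, Submodule.mem_iInf]
  refine forall_congr' fun i => ?_
  rw [LinearMap.mem_ker, ← tensorHom_tensorDelta, map_eq_zero_iff _
    (tensorHom_injective (succAbove_castSucc_injective i) (castSucc_notMem_range i))]

/-- Each substitution alone is already equivalent to lying in the kernel; all are listed to match
the tensor case. -/
theorem mem_wedgeKer_iff (t : (⋀[k]^(r + 1) (PointSpace k S)) ⊗[k] PointSpace k T) :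
    t ∈ wedgeKer k S T (r + 1) ↔ ∀ i : Fin (r + 1), substHom k (Fin.last (r + 1)) i.castSucc
      (wedgeHom k Fin.castSucc (Fin.last (r + 1)) S T t) = 0 := by
  have h : ∀ i : Fin (r + 1), wedgeDelta k S T r t = 0 ↔ substHom k (Fin.last (r + 1)) i.castSucc
      (wedgeHom k Fin.castSucc (Fin.last (r + 1)) S T t) = 0 := by
    intro i
    rw [← map_eq_zero_iff _
      (wedgeHom_injective (succAbove_castSucc_injective i) (castSucc_notMem_range i)),
      wedgeHom_wedgeDelta]
    rcases neg_one_pow_eq_or ℤ ((i : ℕ) + 1) with h | h <;> simp [h]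
  rw [wedgeKer, LinearMap.mem_ker]
  exact ⟨fun ht i => (h i).1 ht, fun ht => (h 0).2 (ht 0)⟩

theorem val_comp_injective (Q : Fin (r + 1) ≃ T) : Function.Injective fun j => (Q j).1 :=
  Subtype.val_injective.comp Q.injective

theorem range_val_comp (Q : Fin (r + 1) ≃ T) : Set.range (fun j => (Q j).1) = T := by
  rw [show (fun j => (Q j).1) = Subtype.val ∘ Q from rfl, Set.range_comp, Q.range_eq_univ,
    Set.image_univ, Subtype.range_val]

theorem exists_eq_vdm_mul' {Δ : Set (Fin n → ℝ)} (hΔ : Convex ℝ Δ) (hS : S = latticePoints Δ)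
    (Q : Fin (r + 2) ≃ T) (hal : ¬ Aligned fun j => (Q j).1)
    {f : AddMonoidAlgebra k (Fin (r + 2) → Fin n → ℤ)}
    (hf : f ∈ suppIn k (box Fin.castSucc (Fin.last (r + 1)) S T))
    (hf0 : ∀ i : Fin (r + 1), substHom k (Fin.last (r + 1)) i.castSucc f = 0) :
    ∃ g ∈ suppIn k (box Fin.castSucc (Fin.last (r + 1)) (shiftSet S T) {0}),
      f = vdm k (fun j => (Q j).1) id * g := by
  subst hS
  have h := exists_eq_vdm_mul (k := k) (f := f) hΔ (val_comp_injective Q) hal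
  rw [range_val_comp Q] at h
  exact h hf hf0

theorem exists_basis_tensorKer {Δ : Set (Fin n → ℝ)} (hΔ : Convex ℝ Δ) (hS : S = latticePoints Δ)
    (Q : Fin (r + 2) ≃ T) (hal : ¬ Aligned fun j => (Q j).1) :
    ∃ b : Module.Basis (Fin (r + 1) → shiftSet S T) k (tensorKer k S T (r + 1)),
      ∀ P, (b P : (⨂[k]^(r + 1) (PointSpace k S)) ⊗[k] PointSpace k T) = xTensor k Q P := by
  have hc := Fin.castSucc_injective (r + 1)
  have hl := last_notMem_range_castSucc (r + 1)
  refine exists_basis (Φ := tensorHom k Fin.castSucc (Fin.last (r + 1)) S T)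
    (tensorHom_injective hc hl) (fun P => ?_)
    (vdm_ne_zero (val_comp_injective Q) Function.injective_id)
    (linearIndependent_single_tupleExpo _) (tensorHom_xTensor Q) fun t ht => ?_
  · rw [mem_tensorKer_iff]
    intro i
    rw [tensorHom_xTensor, map_mul, substHom_vdm, zero_mul]
  · obtain ⟨g, hg, h⟩ := exists_eq_vdm_mul' hΔ hS Q hal (tensorHom_mem_suppIn hc hl t)
      ((mem_tensorKer_iff t).1 ht)
    exact ⟨g, mem_span_single_tupleExpo hg, h⟩

end Tensor

/-! ### Permutations fixing the last letter -/

section Perm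

variable {r : ℕ}

/-- The extension of a permutation to one more letter, which is fixed. -/
def extPerm (τ : Equiv.Perm (Fin r)) : Equiv.Perm (Fin (r + 1)) :=
  τ.viaFintypeEmbedding Fin.castSuccEmb

theorem extPerm_castSucc (τ : Equiv.Perm (Fin r)) (i : Fin r) :
    extPerm τ i.castSucc = (τ i).castSucc :=
  Equiv.Perm.viaFintypeEmbedding_apply_image τ Fin.castSuccEmb i

theorem extPerm_last (τ : Equiv.Perm (Fin r)) : extPerm τ (Fin.last r) = Fin.last r := by
  apply Equiv.Perm.viaFintypeEmbedding_apply_notMem_range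
  rintro ⟨i, hi⟩
  exact Fin.castSucc_ne_last i hi

theorem sign_extPerm (τ : Equiv.Perm (Fin r)) :
    Equiv.Perm.sign (extPerm τ) = Equiv.Perm.sign τ :=
  Equiv.Perm.viaFintypeEmbedding_sign _ _

theorem perm_ext_castSucc {σ τ : Equiv.Perm (Fin (r + 1))}
    (h : ∀ i : Fin r, σ i.castSucc = τ i.castSucc) : σ = τ := by
  have hl : σ (Fin.last r) = τ (Fin.last r) := by
    obtain ⟨a, ha⟩ := τ.surjective (σ (Fin.last r))
    induction a using Fin.lastCases with
    | last => exact ha.symm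
    | cast i =>
      rw [← h] at ha
      exact absurd (σ.injective ha) (Fin.castSucc_ne_last i)
  ext a
  induction a using Fin.lastCases with
  | last => rw [hl]
  | cast i => rw [h]

/-- Both sequences have the same sorted rearrangement. -/
theorem exists_perm_of_map_eq {α : Type*} [LinearOrder α] {f g : Fin r → α}
    (h : Multiset.map f Finset.univ.val = Multiset.map g Finset.univ.val) :
    ∃ σ : Equiv.Perm (Fin r), g ∘ σ = f := by
  have hp : (List.ofFn f).Perm (List.ofFn g) := by
    rwa [Fin.univ_val_map, Fin.univ_val_map, Multiset.coe_eq_coe] at h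
  have hs : f ∘ Tuple.sort f = g ∘ Tuple.sort g := List.ofFn_injective <|
    ((((Tuple.sort f).ofFn_comp_perm f).trans hp).trans
      ((Tuple.sort g).ofFn_comp_perm g).symm).eq_of_pairwise'
      (Tuple.monotone_sort f).sortedLE_ofFn.pairwise (Tuple.monotone_sort g).sortedLE_ofFn.pairwise
  refine ⟨(Tuple.sort f).symm.trans (Tuple.sort g), funext fun i => ?_⟩
  have := congrFun hs ((Tuple.sort f).symm i)
  rw [Function.comp_apply, Equiv.apply_symm_apply] at this
  exact this.symm

theorem map_comp_perm {α : Type*} (f : Fin r → α) (σ : Equiv.Perm (Fin r)) :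
    Multiset.map (f ∘ σ) Finset.univ.val = Multiset.map f Finset.univ.val := by
  rw [← Multiset.map_map, Multiset.map_univ_val_equiv]

end Perm

/-! ### The elements `x_A` -/

section Wedge

variable {k : Type*} [Field k] {n r : ℕ} {S T : Set (Fin n → ℤ)}

open Classical in
/-- The monomial symmetric function of the sequence `P`. -/
def monSymm (k : Type*) [Field k] {n r : ℕ} {X : Set (Fin n → ℤ)} (P : Fin r → X) :
    AddMonoidAlgebra k (Fin (r + 1) → Fin n → ℤ) :=
  ∑ P' ∈ Finset.univ.image (fun τ : Equiv.Perm (Fin r) => P ∘ τ), single (tupleExpo P') 1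

theorem wedgeHom_wedgeTerm (Q : Fin (r + 1) ≃ T) (P : Fin r → shiftSet S T)
    (σ : Equiv.Perm (Fin (r + 1))) :
    wedgeHom k Fin.castSucc (Fin.last r) S T (wedgeTerm k Q P σ) =
      ∑ τ : Equiv.Perm (Fin r), single (tupleExpo (P ∘ τ)) 1 *
        (Equiv.Perm.sign (σ * extPerm τ) • ∏ i, mono k i (Q ((σ * extPerm τ) i)).1) := by
  rw [wedgeTerm, Units.smul_def, map_zsmul, wedgeHom_pt, vdm, Matrix.det_apply, Finset.sum_mul,
    Finset.smul_sum]
  refine Finset.sum_congr rfl fun τ _ => ?_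
  have h := prod_mono_shiftPoint (k := k) Q (P ∘ τ) (σ * extPerm τ)
  simp only [Equiv.Perm.mul_apply, extPerm_castSucc, extPerm_last, Function.comp_apply] at h
  simp only [Matrix.of_apply, Equiv.Perm.mul_apply]
  rw [mul_smul_comm, ← h, Equiv.Perm.sign_mul, sign_extPerm, Units.smul_def, Units.smul_def,
    smul_mul_assoc, smul_smul, Units.val_mul]

-- Expanding the exterior products indexes the left side by pairs of a class `c` and a permutation
-- `τ`; the right side is indexed by pairs of a rearrangement of `P` and a permutation `σ`. The
-- bijection `(c, τ) ↦ (P ∘ τ, c.out * extPerm τ)` matches the terms, with no division by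
-- factorials.
open Classical in
theorem wedgeHom_xWedge (Q : Fin (r + 1) ≃ T) (P : Fin r → shiftSet S T) :
    wedgeHom k Fin.castSucc (Fin.last r) S T (xWedge k Q P) =
      vdm k (fun j => (Q j).1) id * monSymm k P := by
  have hterm : ∀ c : Quotient (permSetoid P),
      Quotient.lift (wedgeTerm k Q P) (wedgeTerm_eq_of_equiv k Q P) c =
        wedgeTerm k Q P c.out := fun c => by
    conv_lhs => rw [← c.out_eq]
    rfl
  rw [xWedge, map_sum, vdm_eq_sum_prod, monSymm, mul_comm, Finset.sum_mul_sum,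
    ← Finset.sum_product', Finset.sum_congr rfl fun c _ => by rw [hterm c, wedgeHom_wedgeTerm],
    ← Finset.sum_product']
  refine Finset.sum_bij (fun z _ => (P ∘ z.2, z.1.out * extPerm z.2)) ?_ ?_ ?_ ?_
  · rintro ⟨c, τ⟩ -
    simp
  · rintro ⟨c, τ⟩ - ⟨c', τ'⟩ - h
    rw [Prod.mk.injEq] at h
    obtain ⟨h1, h2⟩ := h
    have h3 : ∀ i, c.out (τ i).castSucc = c'.out (τ' i).castSucc := fun i => by
      simpa [extPerm_castSucc] using DFunLike.congr_fun h2 i.castSucc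
    have h4 : ∀ i, P (τ i) = P (τ' i) := congrFun h1
    have hc : c = c' := by
      rw [← c.out_eq, ← c'.out_eq]
      refine Quotient.sound fun R => Set.ext fun a => ⟨?_, ?_⟩
      · rintro ⟨i, hi, rfl⟩
        obtain ⟨j, rfl⟩ := τ.surjective i
        exact ⟨τ' j, (h4 j).symm.trans hi, (h3 j).symm⟩
      · rintro ⟨i, hi, rfl⟩
        obtain ⟨j, rfl⟩ := τ'.surjective i
        exact ⟨τ j, (h4 j).trans hi, h3 j⟩
    subst hc
    refine Prod.ext rfl (Equiv.ext fun i => ?_)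
    exact Fin.castSucc_injective _ (c.out.injective (h3 i))
  · rintro ⟨P', σ⟩ hP
    obtain ⟨τ₀, -, hτ₀⟩ := Finset.mem_image.1 (Finset.mem_product.1 hP).1
    change P ∘ τ₀ = P' at hτ₀
    subst hτ₀
    -- The class is that of `σ τ₀⁻¹`. Its representative may differ from `s` within the blocks where
    -- `P` is constant, so `τ₀` has to be corrected to `τ` inside those blocks.
    let s : Equiv.Perm (Fin (r + 1)) := (extPerm τ₀).symm.trans σ
    let c : Quotient (permSetoid P) := Quotient.mk _ s
    have hs : ∀ j : Fin r, s (τ₀ j).castSucc = σ j.castSucc := fun j => by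
      rw [← extPerm_castSucc, Equiv.trans_apply, Equiv.symm_apply_apply]
    have hrel : (permSetoid P).r c.out s := Quotient.mk_out (s := permSetoid P) s
    have hex : ∀ j : Fin r, ∃ i, P i = P (τ₀ j) ∧ c.out i.castSucc = σ j.castSucc := by
      intro j
      have h1 : s (τ₀ j).castSucc ∈ (fun i : Fin r => s i.castSucc) '' {i | P i = P (τ₀ j)} :=
        ⟨τ₀ j, rfl, rfl⟩
      rw [← hrel (P (τ₀ j)), hs] at h1
      obtain ⟨i, hi, hi'⟩ := h1
      exact ⟨i, hi, hi'⟩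
    choose τ hτ hτ' using hex
    have hinj : Function.Injective τ := by
      intro i j hij
      have h1 := hτ' i
      rw [hij, hτ' j] at h1
      exact (Fin.castSucc_injective r (σ.injective h1)).symm
    let e : Equiv.Perm (Fin r) := Equiv.ofBijective τ (Finite.injective_iff_bijective.mp hinj)
    have he : ∀ i, e i = τ i := fun _ => rfl
    refine ⟨(c, e), by simp, Prod.ext (funext fun j => hτ j) (perm_ext_castSucc fun j => ?_)⟩
    rw [Equiv.Perm.mul_apply, extPerm_castSucc, he, hτ']
  · rintro ⟨c, τ⟩ -
    rfl

open Classical in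
theorem coeff_monSymm {X : Set (Fin n → ℤ)} (P P' : Fin r → X) :
    (monSymm k P).coeff (tupleExpo P') = if ∃ τ : Equiv.Perm (Fin r), P ∘ τ = P' then 1 else 0 := by
  rw [monSymm, coeff_sum, Finsupp.finsetSum_apply]
  simp only [coeff_single, Finsupp.single_apply, (tupleExpo_injective X).eq_iff]
  rw [Finset.sum_ite_eq']
  simp

theorem monSymm_mem_suppIn {X : Set (Fin n → ℤ)} (P : Fin r → X) :
    monSymm k P ∈ suppIn k (box Fin.castSucc (Fin.last r) X {0}) := by
  refine Submodule.sum_mem _ fun P' _ => single_mem_suppIn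
    (W := box Fin.castSucc (Fin.last r) X {0}) ⟨fun i => ?_, ?_⟩ _
  · rw [tupleExpo_castSucc]
    exact (P' i).2
  · rw [tupleExpo_last]
    rfl

/-- The permutation of the variables by `e`. -/
def renameHom (k : Type*) [Field k] {n : ℕ} {ι : Type*} (e : Equiv.Perm ι) :
    AddMonoidAlgebra k (ι → Fin n → ℤ) →ₐ[k] AddMonoidAlgebra k (ι → Fin n → ℤ) :=
  mapDomainAlgHom k k (AddMonoidHom.mk' (fun γ : ι → Fin n → ℤ => γ ∘ e.symm) fun _ _ => rfl)

theorem renameHom_mono {ι : Type*} [DecidableEq ι] (e : Equiv.Perm ι) (i : ι) (q : Fin n → ℤ) :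
    renameHom k e (mono k i q) = mono k (e i) q := by
  refine (mapDomain_single (R := k)).trans ?_
  have : (Pi.single i q : ι → Fin n → ℤ) ∘ e.symm = Pi.single (e i) q := by
    funext j
    by_cases h : e i = j
    · subst h
      simp
    · rw [Pi.single_eq_of_ne (Ne.symm h), Function.comp_apply, Pi.single_eq_of_ne]
      rintro rfl
      simp at h
  rw [mono, ← this]
  rfl

theorem coeff_renameHom {ι : Type*} (e : Equiv.Perm ι) (f : AddMonoidAlgebra k (ι → Fin n → ℤ))
    (γ : ι → Fin n → ℤ) : (renameHom k e f).coeff (γ ∘ e.symm) = f.coeff γ := by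
  have hinj : Function.Injective (fun γ : ι → Fin n → ℤ => γ ∘ e.symm) :=
    e.symm.surjective.injective_comp_right
  exact Finsupp.mapDomain_apply hinj f.coeff γ

theorem renameHom_vdm {ι : Type*} [DecidableEq ι] (e : Equiv.Perm ι) (q : Fin r → Fin n → ℤ)
    (c : Fin r → ι) : renameHom k e (vdm k q c) = vdm k q (e ∘ c) := by
  rw [vdm, AlgHom.map_det]
  exact congrArg Matrix.det (Matrix.ext fun _ _ => renameHom_mono e _ _)

theorem vdm_comp_perm {ι : Type*} [DecidableEq ι] (e : Equiv.Perm (Fin r)) (q : Fin r → Fin n → ℤ)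
    (c : Fin r → ι) : vdm k q (c ∘ e) = Equiv.Perm.sign e * vdm k q c :=
  Matrix.det_permute' e (Matrix.of fun j i => mono k (c i) (q j))

theorem renameHom_wedgeHom (e : Equiv.Perm (Fin r))
    (t : (⋀[k]^r (PointSpace k S)) ⊗[k] PointSpace k T) :
    renameHom k (extPerm e) (wedgeHom k Fin.castSucc (Fin.last r) S T t) =
      (Equiv.Perm.sign e : ℤ) • wedgeHom k Fin.castSucc (Fin.last r) S T t := by
  suffices h : (renameHom k (extPerm e)).toLinearMap ∘ₗ
      wedgeHom k Fin.castSucc (Fin.last r) S T =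
        (Equiv.Perm.sign e : ℤ) • wedgeHom k Fin.castSucc (Fin.last r) S T from
    LinearMap.congr_fun h t
  refine (wedgeBasis k S T).ext ?_
  rintro ⟨s, Q⟩
  rw [wedgeBasis_apply, LinearMap.comp_apply, LinearMap.smul_apply, wedgeHom_pt,
    AlgHom.toLinearMap_apply, map_mul, renameHom_mono, extPerm_last, renameHom_vdm,
    show (extPerm e ∘ Fin.castSucc : Fin r → Fin (r + 1)) = Fin.castSucc ∘ e from
      funext fun i => extPerm_castSucc e i, vdm_comp_perm, zsmul_eq_mul, mul_assoc]

/-- Permuting the first `r` variables multiplies both `V * g` and `V` by the sign of `e`, so `g` is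
fixed. Cancelling the sign is legitimate in every characteristic, as it is `±1`. -/
theorem coeff_tupleExpo_comp {X : Set (Fin n → ℤ)} (Q : Fin (r + 1) ≃ T)
    {t : (⋀[k]^r (PointSpace k S)) ⊗[k] PointSpace k T}
    {g : AddMonoidAlgebra k (Fin (r + 1) → Fin n → ℤ)}
    (h : wedgeHom k Fin.castSucc (Fin.last r) S T t = vdm k (fun j => (Q j).1) id * g)
    (P : Fin r → X) (e : Equiv.Perm (Fin r)) :
    g.coeff (tupleExpo (P ∘ e)) = g.coeff (tupleExpo P) := by
  have hg : renameHom k (extPerm e) g = g := by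
    have h1 := renameHom_wedgeHom e t
    have h2 := vdm_comp_perm (k := k) (extPerm e) (fun j => (Q j).1) id
    rw [Function.id_comp, sign_extPerm] at h2
    rw [h, map_mul, renameHom_vdm, Function.comp_id, h2, zsmul_eq_mul, mul_assoc] at h1
    have h3 : ((Equiv.Perm.sign e : ℤ) : AddMonoidAlgebra k (Fin (r + 1) → Fin n → ℤ)) ≠ 0 := by
      rcases Int.units_eq_one_or (Equiv.Perm.sign e) with h | h <;> simp [h]
    exact mul_left_cancel₀ (vdm_ne_zero (val_comp_injective Q) Function.injective_id)
      (mul_left_cancel₀ h3 h1)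
  have hcomp : tupleExpo (P ∘ e) ∘ (extPerm e).symm = tupleExpo P := by
    funext i
    obtain ⟨j, rfl⟩ := (extPerm e).surjective i
    rw [Function.comp_apply, Equiv.symm_apply_apply]
    induction j using Fin.lastCases with
    | last => rw [extPerm_last, tupleExpo_last, tupleExpo_last]
    | cast j => rw [extPerm_castSucc, tupleExpo_castSucc, tupleExpo_castSucc, Function.comp_apply]
  rw [← coeff_renameHom (extPerm e) g (tupleExpo (P ∘ e)), hcomp, hg]

/-- The monomial given by a sequence. -/
def toSym {X : Type*} (P : Fin r → X) : Sym X r :=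
  ⟨Multiset.map P Finset.univ.val, by simp⟩

theorem exists_comp_eq_iff {X : Set (Fin n → ℤ)} {L : Sym X r → Fin r → X}
    (hL : ∀ A : Sym X r, Multiset.map (L A) Finset.univ.val = (A : Multiset _))
    (A : Sym X r) (P : Fin r → X) :
    (∃ τ : Equiv.Perm (Fin r), L A ∘ τ = P) ↔ toSym P = A := by
  constructor
  · rintro ⟨τ, rfl⟩
    exact Subtype.ext ((map_comp_perm (L A) τ).trans (hL A))
  · intro h
    let _ := pointOrder X
    refine exists_perm_of_map_eq ?_
    rw [hL A, ← h]
    rfl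

theorem linearIndependent_monSymm {X : Set (Fin n → ℤ)} {L : Sym X r → Fin r → X}
    (hL : ∀ A : Sym X r, Multiset.map (L A) Finset.univ.val = (A : Multiset _)) :
    LinearIndependent k fun A => monSymm k (L A) := by
  have hLA : ∀ A, toSym (L A) = A := fun A => Subtype.ext (hL A)
  refine LinearIndependent.of_pairwise_dual_eq_zero_one _
    (fun A => coeffHom (tupleExpo (L A))) ?_ ?_
  · intro A A' hne
    rw [coeffHom_apply, coeff_monSymm, if_neg]
    rwa [exists_comp_eq_iff hL, hLA]
  · intro A
    rw [coeffHom_apply, coeff_monSymm, if_pos ⟨1, rfl⟩]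

theorem mem_span_monSymm {X : Set (Fin n → ℤ)} {L : Sym X r → Fin r → X}
    (hL : ∀ A : Sym X r, Multiset.map (L A) Finset.univ.val = (A : Multiset _))
    {g : AddMonoidAlgebra k (Fin (r + 1) → Fin n → ℤ)}
    (hg : g ∈ suppIn k (box Fin.castSucc (Fin.last r) X {0}))
    (hsymm : ∀ (P : Fin r → X) (e : Equiv.Perm (Fin r)),
      g.coeff (tupleExpo (P ∘ e)) = g.coeff (tupleExpo P)) :
    g ∈ Submodule.span k (Set.range fun A => monSymm k (L A)) := by
  classical
  -- The finitely many orbits of exponents that occur in `g`; the coefficient of each orbit is read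
  -- off at its chosen representative.
  let F := (g.coeff.comapDomain tupleExpo (tupleExpo_injective X).injOn).support.image toSym
  have key : g = ∑ A ∈ F, g.coeff (tupleExpo (L A)) • monSymm k (L A) := by
    have hR : (∑ A ∈ F, g.coeff (tupleExpo (L A)) • monSymm k (L A)) ∈
        suppIn k (box Fin.castSucc (Fin.last r) X {0}) :=
      Submodule.sum_mem _ fun A _ => Submodule.smul_mem _ _ (monSymm_mem_suppIn _)
    ext γ
    by_cases hγ : γ ∈ box Fin.castSucc (Fin.last r) X {0}
    · obtain ⟨P, rfl⟩ := exists_tupleExpo_eq hγ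
      rw [coeff_sum, Finsupp.finsetSum_apply]
      simp only [coeff_smul_apply, coeff_monSymm, exists_comp_eq_iff hL, smul_eq_mul, mul_ite,
        mul_one, mul_zero]
      rw [Finset.sum_ite_eq]
      obtain ⟨τ, hτ⟩ := (exists_comp_eq_iff hL (toSym P) P).2 rfl
      have h1 := hsymm (L (toSym P)) τ
      rw [hτ] at h1
      split_ifs with hF
      · exact h1
      · by_contra hne
        exact hF (Finset.mem_image_of_mem _ (Finsupp.mem_support_iff.2 hne))
    · rw [Finsupp.notMem_support_iff.1 (mt (hg γ) hγ), Finsupp.notMem_support_iff.1 (mt (hR γ) hγ)]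
  rw [key]
  exact Submodule.sum_mem _ fun A _ =>
    Submodule.smul_mem _ _ (Submodule.subset_span ⟨A, rfl⟩)

theorem exists_basis_wedgeKer {Δ : Set (Fin n → ℝ)} (hΔ : Convex ℝ Δ) (hS : S = latticePoints Δ)
    (Q : Fin (r + 2) ≃ T) (hal : ¬ Aligned fun j => (Q j).1)
    {L : Sym (shiftSet S T) (r + 1) → Fin (r + 1) → shiftSet S T}
    (hL : ∀ A, Multiset.map (L A) Finset.univ.val = (A : Multiset _)) :
    ∃ b : Module.Basis (Sym (shiftSet S T) (r + 1)) k (wedgeKer k S T (r + 1)),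
      ∀ A, (b A : (⋀[k]^(r + 1) (PointSpace k S)) ⊗[k] PointSpace k T) = xWedge k Q (L A) := by
  have hc := Fin.castSucc_injective (r + 1)
  have hl := last_notMem_range_castSucc (r + 1)
  refine exists_basis (Φ := wedgeHom k Fin.castSucc (Fin.last (r + 1)) S T)
    (wedgeHom_injective hc hl) (fun A => ?_)
    (vdm_ne_zero (val_comp_injective Q) Function.injective_id)
    (linearIndependent_monSymm hL) (fun A => wedgeHom_xWedge Q (L A)) fun t ht => ?_
  · rw [mem_wedgeKer_iff]
    intro i
    rw [wedgeHom_xWedge, map_mul, substHom_vdm, zero_mul]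
  · obtain ⟨g, hg, h⟩ := exists_eq_vdm_mul' hΔ hS Q hal (wedgeHom_mem_suppIn hc hl t)
      ((mem_wedgeKer_iff t).1 ht)
    exact ⟨g, mem_span_monSymm hL hg (coeff_tupleExpo_comp Q h), h⟩

end Wedge

end LaurentAlg

end

theorem mainTheorem3 (k : Type*) [Field k] (n : ℕ) (Δ Δ' : Set (Fin n → ℝ))
    (hΔ : IsLatticePolytope Δ) (hdim : 1 < affineDim Δ) (hΔ' : Convex ℝ Δ')
    (S T : Set (Fin n → ℤ)) (hS : S = latticePoints Δ') (hT : T = latticePoints Δ)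
    (p : ℕ) (hp : T.ncard = p + 1) (Q : Fin (p + 1) ≃ T) :
    (∃ b : Module.Basis (Fin p → shiftSet S T) k (tensorKer k S T p),
      ∀ P : Fin p → shiftSet S T, (b P : (⨂[k]^p (PointSpace k S)) ⊗[k] PointSpace k T) =
        xTensor k Q P) ∧
    ∀ L : Sym (shiftSet S T) p → Fin p → shiftSet S T,
      (∀ A : Sym (shiftSet S T) p, Multiset.map (L A) Finset.univ.val = (A : Multiset _)) →
      ∃ b : Module.Basis (Sym (shiftSet S T) p) k (wedgeKer k S T p),
        ∀ A : Sym (shiftSet S T) p, (b A : (⋀[k]^p (PointSpace k S)) ⊗[k] PointSpace k T) =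
          xWedge k Q (L A) := by
  have hal : ¬ LaurentAlg.Aligned fun j => (Q j).1 := by
    subst hT
    exact LaurentAlg.not_aligned_of_affineDim hΔ hdim Q
  cases p with
  | zero =>
    -- A single point is collinear, so `p = 0` contradicts the dimension hypothesis.
    refine absurd (fun a b c x y => ?_) hal
    rw [show b = a by omega, sub_self]
    simp
  | succ r =>
    exact ⟨LaurentAlg.exists_basis_tensorKer hΔ' hS Q hal,
      fun L hL => LaurentAlg.exists_basis_wedgeKer hΔ' hS Q hal hL⟩
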